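/- **Setting.** Let $n\in\mathbb N$, $n\ge 2$, and let all functions be measurable with respect to Lebesgue measure. For a measurable function $f$ on $\mathbb R^n$ or on $(0,\infty)$ put $f_*(\lambda)=|\{|f|>\lambda\}|$ for $\lambda>0$, and let $f^*(t)=\inf\{\lambda>0: f_*(\lambda)\le t\}$, $t>0$, be its nonincreasing rearrangement; $f$ and $g$ are equimeasurable if $f_*=g_*$. A rearrangement-invariant (r.i.) norm over a measure space $(\mathcal R,\mu)$ is a functional $\|\cdot\|_X$ from the nonnegative measurable functions (with values in $[0,\infty]$) to $[0,\infty]$ such that, for all such $f,g,f_k$, all $\lambda\ge 0$ and all measurable $E\subseteq\mathcal R$: $\|f+g\|_X\le\|f\|_X+\|g\|_X$, $\|\lambda f\|_X=\lambda\|f\|_X$, and $\|f\|_X=0$ iff $f=0$ a.e.; $\|f\|_X\le\|g\|_X$ if $f\le g$ a.e.; $\|f_k\|_X\nearrow\|f\|_X$ if $f_k\nearrow f$ a.e.; $\|\chi_E\|_X<\infty$ if $\mu(E)<\infty$; if $\mu(E)<\infty$ there is $C_{E,X}\in(0,\infty)$ with $\int_E f\,d\mu\le C_{E,X}\|f\|_X$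 for every $f$; and $\|f\|_X=\|g\|_X$ if $f$ and $g$ are equimeasurable. For a general measurable $f$ put $\|f\|_X=\|\,|f|\,\|_X$; the r.i. space is $X=\{f:\|f\|_X<\infty\}$. For an r.i. space $X(\mathbb R^n)$, its representation space $\overline X(0,\infty)$ is the unique r.i. space over $(0,\infty)$ with $\|f\|_{X(\mathbb R^n)}=\|f^*\|_{\overline X(0,\infty)}$ for every measurable $f$ on $\mathbb R^n$. The space $W^1X(\mathbb R^n)$ consists of the weakly differentiable real-valued $u\in X(\mathbb R^n)$ with $|\nabla u|\in X(\mathbb R^n)$, with norm $\|u\|_{W^1X(\mathbb R^n)}=\|u\|_{X(\mathbb R^n)}+\|\,|\nabla u|\,\|_{X(\mathbb R^n)}$, and $W^1_RX(\mathbb R^n)$ is its subspace of radially symmetric functions, that is, of those $u$ with $u(x)=g(|x|)$ for a.e. $x$, for some function $g$. Let $B_R$ be the open ball of radius $R$ centered at the origin. The convention $0\cdot\infty=0$ is used. **Proposition.** For every $n\ge2$ there is a constant $C\in(0,\infty)$, depending only on $n$, such that for all r.i. spaces $X(\mathbb R^n)$ and $Y(\mathbb R^n)$, every $R>0$ and every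 $u\in W^1_RX(\mathbb R^n)$, $$\|u\chi_{\mathbb R^n\setminus B_R}\|_{Y(\mathbb R^n)}\le C\Big(\sup_{\|f\|_{\overline X(0,\infty)}\le1}\|f^*\chi_{(R^{n-1},\infty)}\|_{\overline Y(0,\infty)}\Big)\|u\|_{W^1X(\mathbb R^n)},$$ where the supremum, possibly infinite, is over measurable functions $f$ on $(0,\infty)$. In particular, if $$\lim_{a\to\infty}\ \sup_{\|f\|_{\overline X(0,\infty)}\le1}\|f^*\chi_{(a,\infty)}\|_{\overline Y(0,\infty)}=0,$$ then $$\lim_{R\to\infty}\ \sup_{u\in M}\|u\chi_{\mathbb R^n\setminus B_R}\|_{Y(\mathbb R^n)}=0$$ for every set $M\subseteq W^1_RX(\mathbb R^n)$ that is bounded in the norm of $W^1X(\mathbb R^n)$. -/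

import Mathlib

open MeasureTheory Set Filter Topology
open scoped ENNReal NNReal ContDiff

noncomputable section

/-- The distribution function `f_*(l) = μ {x : f x > l}` of a nonnegative function `f`. -/
def distribution {α : Type*} [MeasurableSpace α] (μ : Measure α) (f : α → ℝ≥0∞) (l : ℝ≥0∞) :
    ℝ≥0∞ :=
  μ {x | l < f x}

/-- Two nonnegative functions are equimeasurable if their distribution functions agree
on `(0, ∞)`. -/
def Equimeasurable {α β : Type*} [MeasurableSpace α] [MeasurableSpace β] (μ : Measure α)
    (ν : Measure β) (f : α → ℝ≥0∞) (g : β → ℝ≥0∞) : Prop :=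
  ∀ l : ℝ≥0∞, 0 < l → l < ⊤ → distribution μ f l = distribution ν g l

/-- The nonincreasing rearrangement `f^*(t) = inf {l ∈ (0, ∞) : f_*(l) ≤ t}`, `t ∈ (0, ∞)`.
(Its values at `t ≤ 0` are never used.) -/
def rearrangement {α : Type*} [MeasurableSpace α] (μ : Measure α) (f : α → ℝ≥0∞) (t : ℝ) :
    ℝ≥0∞ :=
  sInf {l : ℝ≥0∞ | 0 < l ∧ l < ⊤ ∧ distribution μ f l ≤ ENNReal.ofReal t}

/-- The Lebesgue measure on the half-line `(0, ∞)`, seen as a measure on `ℝ`. -/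
abbrev volPos : Measure ℝ := volume.restrict (Ioi (0 : ℝ))

/-- A rearrangement-invariant function norm on the nonnegative (possibly infinite-valued)
`μ`-measurable functions. The values of `norm` at nonmeasurable functions are irrelevant. -/
structure RINorm {α : Type*} [MeasurableSpace α] (μ : Measure α) where
  /-- the functional -/
  norm : (α → ℝ≥0∞) → ℝ≥0∞
  add_le : ∀ f g : α → ℝ≥0∞, AEMeasurable f μ → AEMeasurable g μ →
    norm (fun x => f x + g x) ≤ norm f + norm g
  eq_zero_iff : ∀ f : α → ℝ≥0∞, AEMeasurable f μ → (norm f = 0 ↔ ∀ᵐ x ∂μ, f x = 0)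
  smul_eq : ∀ (c : ℝ≥0) (f : α → ℝ≥0∞), AEMeasurable f μ →
    norm (fun x => (c : ℝ≥0∞) * f x) = c * norm f
  mono : ∀ f g : α → ℝ≥0∞, AEMeasurable f μ → AEMeasurable g μ →
    (∀ᵐ x ∂μ, f x ≤ g x) → norm f ≤ norm g
  iSup_eq : ∀ (F : ℕ → α → ℝ≥0∞) (f : α → ℝ≥0∞), (∀ k, AEMeasurable (F k) μ) →
    AEMeasurable f μ → (∀ᵐ x ∂μ, Monotone (fun k => F k x) ∧ ⨆ k, F k x = f x) →
    ⨆ k, norm (F k) = norm f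
  indicator_lt_top : ∀ s : Set α, MeasurableSet s → μ s < ⊤ →
    norm (s.indicator fun _ => 1) < ⊤
  lintegral_le : ∀ s : Set α, MeasurableSet s → μ s < ⊤ →
    ∃ C : ℝ≥0, 0 < C ∧ ∀ f : α → ℝ≥0∞, AEMeasurable f μ → ∫⁻ x in s, f x ∂μ ≤ C * norm f
  equimeasurable_eq : ∀ f g : α → ℝ≥0∞, AEMeasurable f μ → AEMeasurable g μ →
    Equimeasurable μ μ f g → norm f = norm g

/-- `f` belongs to the r.i. space given by the r.i. norm `X`. -/
def RINorm.Mem {α : Type*} [MeasurableSpace α] {μ : Measure α} (X : RINorm μ) (f : α → ℝ) :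
    Prop :=
  AEMeasurable f μ ∧ X.norm (fun x => ‖f x‖ₑ) < ⊤

/-- The map `x ↦ ω_n |x|^n` from `ℝⁿ` to `(0, ∞)`, where `ω_n` is the volume of the unit ball. -/
def radialVolume (n : ℕ) (x : EuclideanSpace ℝ (Fin n)) : ℝ :=
  (volume (Metric.ball (0 : EuclideanSpace ℝ (Fin n)) 1)).toReal * ‖x‖ ^ n

theorem measurable_radialVolume (n : ℕ) : Measurable (radialVolume n) := by
  unfold radialVolume
  fun_prop

theorem volume_radialVolume_Iic {n : ℕ} (hn : 2 ≤ n) (b : ℝ) :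
    volume (radialVolume n ⁻¹' Iic b) = ENNReal.ofReal b := by
  set w : ℝ := (volume (Metric.ball (0 : EuclideanSpace ℝ (Fin n)) 1)).toReal with hw
  have hn0 : n ≠ 0 := by omega
  have : Nonempty (Fin n) := ⟨⟨0, by omega⟩⟩
  have hfin : volume (Metric.ball (0 : EuclideanSpace ℝ (Fin n)) 1) ≠ ⊤ :=
    measure_ball_lt_top.ne
  have hw0 : 0 < w := ENNReal.toReal_pos (Metric.measure_ball_pos _ _ one_pos).ne' hfin
  rcases lt_or_ge b 0 with hb | hb
  · have : radialVolume n ⁻¹' Iic b = ∅ := by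
      ext x
      simp only [mem_preimage, mem_Iic, mem_empty_iff_false, iff_false, not_le]
      exact lt_of_lt_of_le hb (by unfold radialVolume; positivity)
    rw [this, measure_empty, ENNReal.ofReal_of_nonpos hb.le]
  · set r : ℝ := (b / w) ^ ((n : ℝ)⁻¹) with hr
    have hr0 : 0 ≤ r := by positivity
    have hrn : r ^ n = b / w := Real.rpow_inv_natCast_pow (by positivity) hn0
    have : radialVolume n ⁻¹' Iic b = Metric.closedBall 0 r := by
      ext x
      simp only [mem_preimage, mem_Iic, mem_closedBall_zero_iff, radialVolume, ← hw]
      rw [← pow_le_pow_iff_left₀ (norm_nonneg x) hr0 hn0, hrn, le_div_iff₀ hw0, mul_comm]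
    rw [this, Measure.addHaar_closedBall _ _ hr0, finrank_euclideanSpace, Fintype.card_fin, hrn,
      ← ENNReal.ofReal_toReal hfin, ← hw, ← ENNReal.ofReal_mul (by positivity),
      div_mul_cancel₀ _ hw0.ne']

/-- The map `x ↦ ω_n |x|^n` is measure preserving. -/
theorem measurePreserving_radialVolume {n : ℕ} (hn : 2 ≤ n) :
    MeasurePreserving (radialVolume n) volume volPos := by
  refine ⟨measurable_radialVolume n, ?_⟩
  symm
  refine Measure.ext_of_Ioc _ _ fun a b hab => ?_
  have hI : Ioc a b = Iic b \ Iic a := by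
    ext t
    simp [and_comm]
  rw [Measure.map_apply (measurable_radialVolume n) measurableSet_Ioc,
    hI, preimage_sdiff, measure_sdiff (preimage_mono (Iic_subset_Iic.2 hab.le))
      (measurable_radialVolume n measurableSet_Iic).nullMeasurableSet
      (by rw [volume_radialVolume_Iic hn]; exact ENNReal.ofReal_ne_top),
    volume_radialVolume_Iic hn, volume_radialVolume_Iic hn, ← hI,
    Measure.restrict_apply measurableSet_Ioc, Ioc_inter_Ioi, Real.volume_Ioc]
  rcases le_total a 0 with ha | ha
  · rw [max_eq_right ha, ENNReal.ofReal_of_nonpos ha]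
    simp
  · rw [max_eq_left ha, ENNReal.ofReal_sub _ ha]

theorem distribution_comp {α β : Type*} [MeasurableSpace α] [MeasurableSpace β] {μ : Measure α}
    {ν : Measure β} {T : α → β} (hT : MeasurePreserving T μ ν) {f : β → ℝ≥0∞}
    (hf : AEMeasurable f ν) (l : ℝ≥0∞) :
    distribution μ (fun x => f (T x)) l = distribution ν f l :=
  hT.measure_preimage (nullMeasurableSet_lt aemeasurable_const hf)

/-- The representation norm of an r.i. norm on `ℝⁿ`: the r.i. norm on `(0, ∞)` given by
`‖f‖ = ‖f(ω_n |x|^n)‖_X`. It is the unique r.i. norm `Z` on `(0, ∞)` with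
`‖f‖_X = ‖f^*‖_Z` for all measurable `f` on `ℝⁿ`; see `RINorm.norm_eq_rep_rearrangement` and
`RINorm.rep_unique`. -/
def RINorm.rep {n : ℕ} (hn : 2 ≤ n)
    (X : RINorm (volume : Measure (EuclideanSpace ℝ (Fin n)))) : RINorm volPos where
  norm f := X.norm (fun x => f (radialVolume n x))
  add_le f g hf hg :=
    X.add_le _ _ (hf.comp_quasiMeasurePreserving
        (measurePreserving_radialVolume hn).quasiMeasurePreserving)
      (hg.comp_quasiMeasurePreserving
        (measurePreserving_radialVolume hn).quasiMeasurePreserving)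
  eq_zero_iff f hf := by
    have hT := measurePreserving_radialVolume hn
    refine (X.eq_zero_iff _ (hf.comp_quasiMeasurePreserving hT.quasiMeasurePreserving)).trans ?_
    refine ⟨fun h => ?_, fun h => hT.quasiMeasurePreserving.ae h⟩
    rw [ae_iff] at h ⊢
    refine Eq.trans ?_ h
    exact (hT.measure_preimage (s := {t | ¬ f t = 0})
      (by simpa only [pos_iff_ne_zero] using
        nullMeasurableSet_lt (aemeasurable_const (b := (0 : ℝ≥0∞))) hf)).symm
  smul_eq c f hf :=
    X.smul_eq c _ (hf.comp_quasiMeasurePreserving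
        (measurePreserving_radialVolume hn).quasiMeasurePreserving)
  mono f g hf hg h :=
    X.mono _ _ (hf.comp_quasiMeasurePreserving
        (measurePreserving_radialVolume hn).quasiMeasurePreserving)
      (hg.comp_quasiMeasurePreserving
        (measurePreserving_radialVolume hn).quasiMeasurePreserving)
      ((measurePreserving_radialVolume hn).quasiMeasurePreserving.ae h)
  iSup_eq F f hF hf h :=
    X.iSup_eq _ _ (fun k => (hF k).comp_quasiMeasurePreserving
        (measurePreserving_radialVolume hn).quasiMeasurePreserving)
      (hf.comp_quasiMeasurePreserving
        (measurePreserving_radialVolume hn).quasiMeasurePreserving)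
      ((measurePreserving_radialVolume hn).quasiMeasurePreserving.ae h)
  indicator_lt_top s hs hμ := by
    have hT := measurePreserving_radialVolume hn
    exact X.indicator_lt_top (radialVolume n ⁻¹' s) (hT.measurable hs)
      (by rwa [hT.measure_preimage hs.nullMeasurableSet])
  lintegral_le s hs hμ := by
    have hT := measurePreserving_radialVolume hn
    obtain ⟨C, hC, h⟩ := X.lintegral_le (radialVolume n ⁻¹' s) (hT.measurable hs)
      (by rwa [hT.measure_preimage hs.nullMeasurableSet])
    refine ⟨C, hC, fun f hf => ?_⟩
    have hT' := hT.restrict_preimage hs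
    have hf' : AEMeasurable f ((volPos.restrict s)) := hf.restrict
    have e : ∫⁻ t in s, f t ∂volPos
        = ∫⁻ x in radialVolume n ⁻¹' s, f (radialVolume n x) := by
      conv_lhs => rw [← hT'.map_eq]
      exact lintegral_map' (by rw [hT'.map_eq]; exact hf') hT'.measurable.aemeasurable
    rw [e]
    exact h _ (hf.comp_quasiMeasurePreserving hT.quasiMeasurePreserving)
  equimeasurable_eq f g hf hg h := by
    have hT := measurePreserving_radialVolume hn
    refine X.equimeasurable_eq _ _ (hf.comp_quasiMeasurePreserving hT.quasiMeasurePreserving) (hg.comp_quasiMeasurePreserving hT.quasiMeasurePreserving)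
      fun l h0 h1 => ?_
    rw [distribution_comp hT hf, distribution_comp hT hg]
    exact h l h0 h1

theorem rearrangement_antitone {α : Type*} [MeasurableSpace α] (μ : Measure α)
    (f : α → ℝ≥0∞) : Antitone (rearrangement μ f) := fun _ _ hst =>
  sInf_le_sInf fun _ hl => ⟨hl.1, hl.2.1, hl.2.2.trans (ENNReal.ofReal_le_ofReal hst)⟩

theorem lt_rearrangement_iff {α : Type*} [MeasurableSpace α] (μ : Measure α)
    (f : α → ℝ≥0∞) {l : ℝ≥0∞} (h0 : 0 < l) (h1 : l < ⊤) (t : ℝ) :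
    l < rearrangement μ f t ↔ ENNReal.ofReal t < distribution μ f l := by
  constructor
  · intro h
    by_contra! hc
    exact absurd (sInf_le ⟨h0, h1, hc⟩ : rearrangement μ f t ≤ l) (not_le.2 h)
  · contrapose!
    intro h
    have key : ∀ m, l < m → distribution μ f m ≤ ENNReal.ofReal t := fun m hm => by
      obtain ⟨k, hk, hkm⟩ := sInf_lt_iff.1 (lt_of_le_of_lt h hm)
      exact (measure_mono fun x (hx : m < f x) => hkm.trans hx).trans hk.2.2
    obtain ⟨u, hu, hul, hlim⟩ := exists_seq_strictAnti_tendsto' h1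
    have hset : {x | l < f x} = ⋃ k, {x | u k < f x} := by
      ext x
      simp only [mem_ofPred_eq, mem_iUnion]
      exact ⟨fun hx => ((hlim.eventually_lt_const hx).exists), fun ⟨k, hk⟩ => (hul k).1.trans hk⟩
    have hmono : Monotone fun k => {x | u k < f x} := fun i j hij x (hx : u i < f x) =>
      lt_of_le_of_lt (hu.antitone hij) hx
    unfold distribution
    rw [hset, hmono.measure_iUnion]
    exact iSup_le fun k => key _ (hul k).1

/-- A function and its nonincreasing rearrangement are equimeasurable. -/
theorem equimeasurable_rearrangement {α : Type*} [MeasurableSpace α] (μ : Measure α)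
    (f : α → ℝ≥0∞) : Equimeasurable μ volPos f (rearrangement μ f) := by
  intro l h0 h1
  conv_rhs => unfold distribution
  simp only [lt_rearrangement_iff μ f h0 h1]
  rw [Measure.restrict_apply (measurableSet_lt ENNReal.measurable_ofReal measurable_const)]
  generalize distribution μ f l = d
  induction d with
  | top => simp
  | coe d =>
    have : {t : ℝ | ENNReal.ofReal t < (d : ℝ≥0∞)} ∩ Ioi 0 = Ioo 0 (d : ℝ) := by
      ext t
      simp only [mem_inter_iff, mem_ofPred_eq, mem_Ioi, mem_Ioo]
      constructor
      · rintro ⟨h, ht⟩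
        refine ⟨ht, ?_⟩
        rwa [← ENNReal.ofReal_coe_nnreal, ENNReal.ofReal_lt_ofReal_iff_of_nonneg ht.le] at h
      · rintro ⟨ht, h⟩
        refine ⟨?_, ht⟩
        rwa [← ENNReal.ofReal_coe_nnreal, ENNReal.ofReal_lt_ofReal_iff_of_nonneg ht.le]
    rw [this, Real.volume_Ioo, sub_zero, ENNReal.ofReal_coe_nnreal]

/-- The defining property of the representation norm. -/
theorem RINorm.norm_eq_rep_rearrangement {n : ℕ} (hn : 2 ≤ n)
    (X : RINorm (volume : Measure (EuclideanSpace ℝ (Fin n))))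
    (f : EuclideanSpace ℝ (Fin n) → ℝ≥0∞) (hf : AEMeasurable f) :
    X.norm f = (X.rep hn).norm (rearrangement volume f) := by
  have hm : AEMeasurable (rearrangement volume f) volPos :=
    (rearrangement_antitone _ f).measurable.aemeasurable
  have hT := measurePreserving_radialVolume hn
  refine X.equimeasurable_eq _ _ hf (hm.comp_quasiMeasurePreserving hT.quasiMeasurePreserving) fun l h0 h1 => ?_
  rw [distribution_comp hT hm]
  exact equimeasurable_rearrangement _ f l h0 h1

/-- The defining property determines the representation norm. -/
theorem RINorm.rep_unique {n : ℕ} (hn : 2 ≤ n)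
    (X : RINorm (volume : Measure (EuclideanSpace ℝ (Fin n)))) (Z : RINorm volPos)
    (hZ : ∀ f : EuclideanSpace ℝ (Fin n) → ℝ≥0∞, AEMeasurable f →
      X.norm f = Z.norm (rearrangement volume f))
    (h : ℝ → ℝ≥0∞) (hh : AEMeasurable h volPos) : Z.norm h = (X.rep hn).norm h := by
  have hT := measurePreserving_radialVolume hn
  have hhT := hh.comp_quasiMeasurePreserving hT.quasiMeasurePreserving
  refine Eq.trans ?_ (hZ _ hhT).symm
  refine Z.equimeasurable_eq _ _ hh
    (rearrangement_antitone _ _).measurable.aemeasurable fun l h0 h1 => ?_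
  rw [← distribution_comp hT hh]
  exact equimeasurable_rearrangement _ _ l h0 h1

/-- The quantity `sup_{‖f‖_X ≤ 1} ‖f^* χ_(a,∞)‖_Y` for r.i. norms `X`, `Y` on `(0, ∞)`. -/
def tailConstant (X Y : RINorm volPos) (a : ℝ) : ℝ≥0∞ :=
  ⨆ (f : ℝ → ℝ≥0∞) (_ : AEMeasurable f volPos) (_ : X.norm f ≤ 1),
    Y.norm ((Ioi a).indicator (rearrangement volPos f))

/-- `G` is a weak gradient of `u` on `ℝⁿ`: both are locally integrable and
`∫ u ∂ᵢφ = - ∫ Gᵢ φ` for every `i` and every smooth compactly supported test function `φ`. -/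
def HasWeakGradient {n : ℕ} (u : EuclideanSpace ℝ (Fin n) → ℝ)
    (G : EuclideanSpace ℝ (Fin n) → EuclideanSpace ℝ (Fin n)) : Prop :=
  LocallyIntegrable u ∧ LocallyIntegrable G ∧
    ∀ φ : EuclideanSpace ℝ (Fin n) → ℝ, ContDiff ℝ ∞ φ → HasCompactSupport φ → ∀ i : Fin n,
      ∫ x, u x * fderiv ℝ φ x (EuclideanSpace.single i 1) = - ∫ x, G x i * φ x

open Classical in
/-- The weak gradient of `u` (unique up to null sets); zero if `u` has none. -/
def weakGradient {n : ℕ} (u : EuclideanSpace ℝ (Fin n) → ℝ) :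
    EuclideanSpace ℝ (Fin n) → EuclideanSpace ℝ (Fin n) :=
  if h : ∃ G, HasWeakGradient u G then h.choose else 0

/-- `u` belongs to the Sobolev space `W¹X(ℝⁿ)`. -/
def MemW1 {n : ℕ} (X : RINorm (volume : Measure (EuclideanSpace ℝ (Fin n))))
    (u : EuclideanSpace ℝ (Fin n) → ℝ) : Prop :=
  X.Mem u ∧ (∃ G, HasWeakGradient u G) ∧ X.Mem (fun x => ‖weakGradient u x‖)

/-- The norm `‖u‖_X + ‖|∇u|‖_X` of `W¹X(ℝⁿ)`. -/
def normW1 {n : ℕ} (X : RINorm (volume : Measure (EuclideanSpace ℝ (Fin n))))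
    (u : EuclideanSpace ℝ (Fin n) → ℝ) : ℝ≥0∞ :=
  X.norm (fun x => ‖u x‖ₑ) + X.norm (fun x => ‖weakGradient u x‖ₑ)

/-- `u` is radially symmetric: it agrees a.e. with a function of `|x|`. -/
def IsRadial {n : ℕ} (u : EuclideanSpace ℝ (Fin n) → ℝ) : Prop :=
  ∃ g : ℝ → ℝ, ∀ᵐ x, u x = g ‖x‖

/-- The subspace `W¹_R X(ℝⁿ)` of radially symmetric functions in `W¹X(ℝⁿ)`. -/
def radialW1 {n : ℕ} (X : RINorm (volume : Measure (EuclideanSpace ℝ (Fin n)))) :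
    Set (EuclideanSpace ℝ (Fin n) → ℝ) :=
  {u | MemW1 X u ∧ IsRadial u}

/-- The norm `‖u χ_{ℝⁿ ∖ B_R}‖_Y`, with `B_R` the open ball of radius `R` about the origin. -/
def tailNorm {n : ℕ} (Y : RINorm (volume : Measure (EuclideanSpace ℝ (Fin n)))) (R : ℝ)
    (u : EuclideanSpace ℝ (Fin n) → ℝ) : ℝ≥0∞ :=
  Y.norm (fun x => ‖(Metric.ball (0 : EuclideanSpace ℝ (Fin n)) R)ᶜ.indicator u x‖ₑ)

end

noncomputable section

/-! The mechanism is to dominate `u` outside the ball by step functions built from averages of a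
majorant `h` of |u| and |∇u| (essentially h = |u| + |∇u|), and to compare the `Y`- and `X`-norms of
those step functions.

Write V = ω_n|x|^n and u = γ(V). Testing the weak gradient against θ(V)y, whose divergence is
n(vθ)'(V), bounds the oscillation of γ on a shell by n⁻¹∫|∇u||y|/V over that shell. Hence |u| on a
shell is at most a mean of |u| plus this integral (`IsRadial.ae_enorm_le_lavg_add_shellOsc`).

For R ≥ 1, cut the exterior of B_R into shells of thickness 2/ω_n. Each has volume at least
2R^{n-1}, and the oscillation is at most a constant times the mean of |∇u|, so |u| ≤ C·F there,
where F equals the mean of h on each shell. Averaging does not increase the `X`-norm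
(`norm_iSup_lavg_le`). Every nonempty superlevel set of F contains a shell, so F^* is constant on
(0, 2R^{n-1}), and its part on (0, R^{n-1}] costs no more than its part beyond R^{n-1}. This gives
‖F‖_Y ≤ 2·(tail constant)·‖F‖_X (`norm_le_tailConstant_mul`).

For R < 1 the region between R and 1 is treated with the balls of radius 2^{j+1}R. There |u| is at
most a sum of multiples 2^jR of means of h over those balls. A ball smaller than 2R^{n-1} is
compared with finitely many copies of itself (`norm_indicator_le_tailConstant_mul`), and the
resulting coefficients have a sum bounded by a constant depending only on n, because n ≥ 2
(`sum_dyadic_le`). The part outside the unit ball is the case R = 1.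

That averaging is a contraction follows from rearrangement invariance and the triangle inequality: a
step function on cells of equal measure, averaged over all cyclic shifts of its cells, becomes
constant, and each shift has the same distribution function (`norm_sum_average_le`). Riemann sums of
the rearrangement reduce general functions to this case. -/

/-! ### Rearrangements and first consequences of the norm axioms -/

/-- `lt_rearrangement_iff` holds at finite positive levels only, so inequalities between
rearrangements are tested at those levels. -/
theorem ENNReal.le_of_forall_finite_lt {a b : ℝ≥0∞}
    (h : ∀ l, 0 < l → l < ⊤ → l < a → l < b) : a ≤ b := by
  refine le_of_forall_lt fun c hc => ?_
  obtain ⟨d, hcd, hda⟩ := exists_between hc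
  exact hcd.trans (h d (bot_lt_of_lt hcd) (hda.trans_le le_top) hda)

theorem rearrangement_le_rearrangement {α β : Type*} [MeasurableSpace α] [MeasurableSpace β]
    {μ : Measure α} {ν : Measure β} {f : α → ℝ≥0∞} {g : β → ℝ≥0∞}
    (h : ∀ l, 0 < l → l < ⊤ → distribution μ f l ≤ distribution ν g l) (t : ℝ) :
    rearrangement μ f t ≤ rearrangement ν g t :=
  sInf_le_sInf fun l hl => ⟨hl.1, hl.2.1, (h l hl.1 hl.2.1).trans hl.2.2⟩

theorem Equimeasurable.rearrangement_eq {α β : Type*} [MeasurableSpace α] [MeasurableSpace β]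
    {μ : Measure α} {ν : Measure β} {f : α → ℝ≥0∞} {g : β → ℝ≥0∞}
    (h : Equimeasurable μ ν f g) : rearrangement μ f = rearrangement ν g :=
  funext fun t => le_antisymm
    (rearrangement_le_rearrangement (fun l h0 h1 => (h l h0 h1).le) t)
    (rearrangement_le_rearrangement (fun l h0 h1 => (h l h0 h1).ge) t)

theorem measurable_rearrangement {α : Type*} [MeasurableSpace α] (μ : Measure α)
    (f : α → ℝ≥0∞) : Measurable (rearrangement μ f) :=
  (rearrangement_antitone μ f).measurable

theorem rearrangement_const_mul {α : Type*} [MeasurableSpace α] (μ : Measure α) {c : ℝ≥0∞}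
    (hc : c ≠ 0) (hc' : c ≠ ⊤) (f : α → ℝ≥0∞) (t : ℝ) :
    rearrangement μ (fun x => c * f x) t = c * rearrangement μ f t := by
  have key : ∀ l, 0 < l → l < ⊤ →
      (l < rearrangement μ (fun x => c * f x) t ↔ l < c * rearrangement μ f t) := by
    intro l h0 h1
    have e : ∀ b : ℝ≥0∞, l < c * b ↔ l / c < b := fun b => by
      rw [ENNReal.div_lt_iff (Or.inl hc) (Or.inl hc'), mul_comm]
    have : distribution μ (fun x => c * f x) l = distribution μ f (l / c) := by
      simp only [distribution, e]
    rw [lt_rearrangement_iff μ _ h0 h1, this, e,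
      lt_rearrangement_iff μ _ (ENNReal.div_pos h0.ne' hc') (ENNReal.div_lt_top h1.ne hc)]
  exact le_antisymm (ENNReal.le_of_forall_finite_lt fun l h0 h1 => (key l h0 h1).1)
    (ENNReal.le_of_forall_finite_lt fun l h0 h1 => (key l h0 h1).2)

theorem volPos_lt (d : ℝ≥0∞) : volPos {t | ENNReal.ofReal t < d} = d := by
  rw [Measure.restrict_apply (measurableSet_lt ENNReal.measurable_ofReal measurable_const)]
  induction d with
  | top => simp
  | coe d =>
    have : {t : ℝ | ENNReal.ofReal t < (d : ℝ≥0∞)} ∩ Ioi 0 = Ioo 0 (d : ℝ) := by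
      ext t
      simp only [mem_inter_iff, mem_ofPred_eq, mem_Ioi, mem_Ioo]
      rw [and_comm]
      refine and_congr_right fun ht => ?_
      rw [← ENNReal.ofReal_coe_nnreal, ENNReal.ofReal_lt_ofReal_iff_of_nonneg ht.le]
    rw [this, Real.volume_Ioo, sub_zero, ENNReal.ofReal_coe_nnreal]

namespace RINorm

/-- An r.i. norm on `(0, ∞)` is monotone with respect to the distribution function. -/
theorem norm_le_of_distribution_le' (Z : RINorm volPos) {f g : ℝ → ℝ≥0∞}
    (hf : AEMeasurable f volPos) (hg : AEMeasurable g volPos)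
    (h : ∀ l, 0 < l → l < ⊤ → distribution volPos f l ≤ distribution volPos g l) :
    Z.norm f ≤ Z.norm g := by
  have hf' := (measurable_rearrangement volPos f).aemeasurable (μ := volPos)
  have hg' := (measurable_rearrangement volPos g).aemeasurable (μ := volPos)
  rw [Z.equimeasurable_eq _ _ hf hf' (equimeasurable_rearrangement _ f),
    Z.equimeasurable_eq _ _ hg hg' (equimeasurable_rearrangement _ g)]
  exact Z.mono _ _ hf' hg' (ae_of_all _ (rearrangement_le_rearrangement h))

section

variable {n : ℕ}

/-- An r.i. norm on `ℝⁿ` is monotone with respect to the distribution function. -/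
theorem norm_le_of_distribution_le (hn : 2 ≤ n)
    (X : RINorm (volume : Measure (EuclideanSpace ℝ (Fin n))))
    {f g : EuclideanSpace ℝ (Fin n) → ℝ≥0∞} (hf : AEMeasurable f) (hg : AEMeasurable g)
    (h : ∀ l, 0 < l → l < ⊤ → distribution volume f l ≤ distribution volume g l) :
    X.norm f ≤ X.norm g := by
  rw [X.norm_eq_rep_rearrangement hn f hf, X.norm_eq_rep_rearrangement hn g hg]
  exact (X.rep hn).mono _ _ (measurable_rearrangement _ _).aemeasurable
    (measurable_rearrangement _ _).aemeasurable (ae_of_all _ (rearrangement_le_rearrangement h))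

end

variable {α : Type*} [MeasurableSpace α] {μ : Measure α}

theorem norm_zero (X : RINorm μ) : X.norm (fun _ => 0) = 0 :=
  (X.eq_zero_iff _ aemeasurable_const).2 (ae_of_all _ fun _ => rfl)

theorem norm_sum_le (X : RINorm μ) {ι : Type*} (s : Finset ι) (f : ι → α → ℝ≥0∞)
    (hf : ∀ i ∈ s, AEMeasurable (f i) μ) :
    X.norm (fun x => ∑ i ∈ s, f i x) ≤ ∑ i ∈ s, X.norm (f i) := by
  classical
  induction s using Finset.induction_on with
  | empty => simp [X.norm_zero]
  | insert i s hi ih =>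
    simp only [Finset.sum_insert hi]
    refine (X.add_le _ _ (hf i (Finset.mem_insert_self i s)) ?_).trans
      (add_le_add le_rfl (ih fun j hj => hf j (Finset.mem_insert_of_mem hj)))
    exact Finset.aemeasurable_fun_sum _ fun j hj => hf j (Finset.mem_insert_of_mem hj)

/-- Homogeneity with respect to an extended nonnegative constant. -/
theorem norm_const_mul_le (X : RINorm μ) (c : ℝ≥0∞) {f : α → ℝ≥0∞} (hf : AEMeasurable f μ) :
    X.norm (fun x => c * f x) ≤ c * X.norm f := by
  induction c with
  | coe c => exact (X.smul_eq c f hf).le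
  | top =>
    rcases eq_or_ne (X.norm f) 0 with h | h
    · rw [h, mul_zero, (X.eq_zero_iff _ (hf.const_mul ⊤)).2]
      filter_upwards [(X.eq_zero_iff f hf).1 h] with x hx
      rw [hx, mul_zero]
    · rw [ENNReal.top_mul h]
      exact le_top

theorem norm_const_mul (X : RINorm μ) {c : ℝ≥0∞} (hc : c ≠ ⊤) {f : α → ℝ≥0∞}
    (hf : AEMeasurable f μ) : X.norm (fun x => c * f x) = c * X.norm f := by
  lift c to ℝ≥0 using hc
  exact X.smul_eq c f hf

theorem norm_indicator_const (X : RINorm μ) {c : ℝ≥0∞} (hc : c ≠ ⊤) {s : Set α}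
    (hs : MeasurableSet s) :
    X.norm (s.indicator fun _ => c) = c * X.norm (s.indicator fun _ => 1) := by
  rw [← X.norm_const_mul hc (aemeasurable_const.indicator hs)]
  congr 1
  ext x
  by_cases hx : x ∈ s <;> simp [hx]

end RINorm

/-! ### The tail constant and functions with large superlevel sets -/

theorem tailConstant_antitone (X Y : RINorm volPos) : Antitone (tailConstant X Y) := by
  intro a b hab
  refine iSup_mono fun f => iSup_mono fun hf => iSup_mono fun _ => ?_
  refine Y.mono _ _ ((measurable_rearrangement _ _).aemeasurable.indicator measurableSet_Ioi)
    ((measurable_rearrangement _ _).aemeasurable.indicator measurableSet_Ioi)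
    (ae_of_all _ fun x => ?_)
  exact indicator_le_indicator_of_subset (Ioi_subset_Ioi hab) (fun _ => zero_le) x

/-- Homogeneity: divide `f` by its norm and use that the rearrangement commutes with positive finite
scalars. If the norm is zero, the rearrangement vanishes a.e. and so does the left side. -/
theorem norm_indicator_rearrangement_le_tailConstant (X Y : RINorm volPos) (a : ℝ)
    {f : ℝ → ℝ≥0∞} (hf : AEMeasurable f volPos) (hfin : X.norm f < ⊤) :
    Y.norm ((Ioi a).indicator (rearrangement volPos f)) ≤ tailConstant X Y a * X.norm f := by
  have hm := (measurable_rearrangement volPos f).aemeasurable (μ := volPos)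
  rcases eq_or_ne (X.norm f) 0 with h0 | h0
  · refine le_of_eq_of_le ?_ zero_le
    rw [Y.eq_zero_iff _ (hm.indicator measurableSet_Ioi)]
    have h : X.norm (rearrangement volPos f) = 0 := by
      rw [← h0]
      exact (X.equimeasurable_eq _ _ hf hm (equimeasurable_rearrangement _ f)).symm
    filter_upwards [(X.eq_zero_iff _ hm).1 h] with x hx
    by_cases hxa : x ∈ Ioi a <;> simp [hxa, hx]
  · set x := X.norm f
    have hx0 : x⁻¹ ≠ 0 := ENNReal.inv_ne_zero.2 hfin.ne
    have hx1 : x⁻¹ ≠ ⊤ := ENNReal.inv_ne_top.2 h0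
    have hle : Y.norm ((Ioi a).indicator (rearrangement volPos fun t => x⁻¹ * f t))
        ≤ tailConstant X Y a := by
      refine le_iSup_of_le (fun t => x⁻¹ * f t) (le_iSup_of_le (hf.const_mul _)
        (le_iSup_of_le ?_ le_rfl))
      rw [X.norm_const_mul hx1 hf, ENNReal.inv_mul_cancel h0 hfin.ne]
    have e : ((Ioi a).indicator (rearrangement volPos fun t => x⁻¹ * f t))
        = fun t => x⁻¹ * (Ioi a).indicator (rearrangement volPos f) t := by
      ext t
      by_cases ht : t ∈ Ioi a <;>
        simp only [ht, indicator_of_mem, indicator_of_notMem, not_false_eq_true, mul_zero,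
          rearrangement_const_mul _ hx0 hx1]
    rw [e, Y.norm_const_mul hx1 (hm.indicator measurableSet_Ioi)] at hle
    rwa [mul_comm, ← div_eq_mul_inv, ENNReal.div_le_iff h0 hfin.ne] at hle

theorem volume_radialVolume_preimage {n : ℕ} (hn : 2 ≤ n) {s : Set ℝ} (hs : MeasurableSet s) :
    volume (radialVolume n ⁻¹' s) = volPos s :=
  (measurePreserving_radialVolume hn).measure_preimage hs.nullMeasurableSet

theorem volPos_Ico {a b : ℝ} (ha : 0 ≤ a) : volPos (Ico a b) = ENNReal.ofReal (b - a) := by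
  refine le_antisymm ((Measure.restrict_apply_le _ _).trans Real.volume_Ico.le) ?_
  rw [Measure.restrict_apply measurableSet_Ico, ← Real.volume_Ioo]
  exact measure_mono fun x hx => ⟨⟨hx.1.le, hx.2⟩, ha.trans_lt hx.1⟩

theorem volume_radialVolume_Ico {n : ℕ} (hn : 2 ≤ n) {a b : ℝ} (ha : 0 ≤ a) :
    volume (radialVolume n ⁻¹' Ico a b) = ENNReal.ofReal (b - a) := by
  rw [volume_radialVolume_preimage hn measurableSet_Ico, volPos_Ico ha]

theorem distribution_indicator_one {α : Type*} [MeasurableSpace α] (μ : Measure α) (s : Set α)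
    (l : ℝ≥0∞) : distribution μ (s.indicator fun _ => 1) l = if l < 1 then μ s else 0 := by
  unfold distribution
  split_ifs with h
  · congr 1
    ext x
    by_cases hx : x ∈ s <;> simp [hx, h]
  · rw [show {x | l < s.indicator (fun _ => (1 : ℝ≥0∞)) x} = ∅ from ?_, measure_empty]
    ext x
    by_cases hx : x ∈ s <;> simp [hx, not_lt.1 h]

namespace RINorm

variable {n : ℕ}

/-- A function whose nonempty superlevel sets have measure at least `2 a` is controlled in `Y` by
its norm in `X` through the tail constant at `a`. -/
theorem norm_le_tailConstant_mul (hn : 2 ≤ n)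
    (X Y : RINorm (volume : Measure (EuclideanSpace ℝ (Fin n)))) {a : ℝ} (ha : 0 < a)
    {F : EuclideanSpace ℝ (Fin n) → ℝ≥0∞} (hF : AEMeasurable F) (hfin : X.norm F < ⊤)
    (hdist : ∀ l, 0 < l → l < ⊤ →
      distribution volume F l = 0 ∨ ENNReal.ofReal (2 * a) ≤ distribution volume F l) :
    Y.norm F ≤ 2 * tailConstant (X.rep hn) (Y.rep hn) a * X.norm F := by
  set r := rearrangement volume F with hr
  have hm : AEMeasurable r volPos := (measurable_rearrangement _ _).aemeasurable
  have hI : AEMeasurable ((Iic a).indicator r) volPos := hm.indicator measurableSet_Iic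
  have hJ : AEMeasurable ((Ioi a).indicator r) volPos := hm.indicator measurableSet_Ioi
  have hXr : X.norm F = (X.rep hn).norm r := X.norm_eq_rep_rearrangement hn F hF
  have hrr : rearrangement volPos r = r :=
    (equimeasurable_rearrangement volume F).rearrangement_eq.symm
  have htail : (Y.rep hn).norm ((Ioi a).indicator r) ≤
      tailConstant (X.rep hn) (Y.rep hn) a * X.norm F := by
    have := norm_indicator_rearrangement_le_tailConstant (X.rep hn) (Y.rep hn) a hm
      (by rwa [← hXr])
    rwa [hrr, ← hXr] at this
  -- At a level where the distribution of `F` is nonzero, the head exceeds it on a set of measure at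
  -- most a, while the tail exceeds it on all of (a, 2a), which has measure a.
  have hhead : (Y.rep hn).norm ((Iic a).indicator r) ≤ (Y.rep hn).norm ((Ioi a).indicator r) := by
    refine norm_le_of_distribution_le' _ hI hJ fun l h0 h1 => ?_
    rcases hdist l h0 h1 with hd | hd
    · refine le_of_eq_of_le ?_ zero_le
      unfold distribution
      convert measure_empty (μ := volPos)
      ext t
      have := lt_rearrangement_iff volume F h0 h1 t
      rw [hd] at this
      by_cases ht : t ≤ a <;> simp [ht, ← hr] at this ⊢
      exact this
    · calc distribution volPos ((Iic a).indicator r) l ≤ volPos (Iic a) := by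
            refine measure_mono fun t (ht : l < (Iic a).indicator r t) => ?_
            by_contra hta
            rw [indicator_of_notMem hta] at ht
            exact not_lt_zero ht
        _ = ENNReal.ofReal (2 * a - a) := by
            rw [Measure.restrict_apply measurableSet_Iic, inter_comm, Ioi_inter_Iic,
              Real.volume_Ioc]
            ring_nf
        _ = volPos (Ico a (2 * a)) := (volPos_Ico ha.le).symm
        _ = volPos (Ioo a (2 * a)) := by
            rw [measure_congr Ioo_ae_eq_Ico]
        _ ≤ distribution volPos ((Ioi a).indicator r) l := by
            refine measure_mono fun t ht => ?_
            change l < (Ioi a).indicator r t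
            rw [indicator_of_mem (show t ∈ Ioi a from ht.1), hr, lt_rearrangement_iff _ _ h0 h1]
            exact (ENNReal.ofReal_lt_ofReal_iff (by linarith)).2 ht.2 |>.trans_le hd
  calc Y.norm F = (Y.rep hn).norm r := Y.norm_eq_rep_rearrangement hn F hF
    _ = (Y.rep hn).norm (fun t => (Iic a).indicator r t + (Ioi a).indicator r t) := by
        congr 1
        ext t
        by_cases ht : t ≤ a
        · simp [ht]
        · simp [ht, not_le.1 ht]
    _ ≤ _ := (Y.rep hn).add_le _ _ hI hJ
    _ ≤ _ := add_le_add (hhead.trans htail) htail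
    _ = _ := by ring

theorem norm_indicator_le (hn : 2 ≤ n)
    (X : RINorm (volume : Measure (EuclideanSpace ℝ (Fin n))))
    {s t : Set (EuclideanSpace ℝ (Fin n))} (hs : MeasurableSet s)
    (ht : MeasurableSet t) (h : volume s ≤ volume t) :
    X.norm (s.indicator fun _ => 1) ≤ X.norm (t.indicator fun _ => 1) := by
  refine X.norm_le_of_distribution_le hn (aemeasurable_const.indicator hs)
    (aemeasurable_const.indicator ht) fun l _ _ => ?_
  simp only [distribution_indicator_one]
  split_ifs
  exacts [h, le_rfl]

/-- By rearrangement `s` may be replaced by the ball of volume k|t|. That ball is the union of k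
shells of volume |t|, each with the same indicator norm as `t`. -/
theorem norm_indicator_le_natCast_mul (hn : 2 ≤ n)
    (X : RINorm (volume : Measure (EuclideanSpace ℝ (Fin n))))
    {s t : Set (EuclideanSpace ℝ (Fin n))}
    (hs : MeasurableSet s) (ht : MeasurableSet t) (htop : volume t ≠ ⊤) (k : ℕ)
    (h : volume s ≤ k * volume t) :
    X.norm (s.indicator fun _ => 1) ≤ k * X.norm (t.indicator fun _ => 1) := by
  set m := (volume t).toReal
  have hm : 0 ≤ m := ENNReal.toReal_nonneg
  have hmt : volume t = ENNReal.ofReal m := (ENNReal.ofReal_toReal htop).symm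
  have hV := measurable_radialVolume n
  let B : ℕ → Set (EuclideanSpace ℝ (Fin n)) := fun i =>
    radialVolume n ⁻¹' Ico (i * m) ((i + 1) * m)
  have hB : ∀ i, MeasurableSet (B i) := fun i => hV measurableSet_Ico
  have hBv : ∀ i, volume (B i) = volume t := fun i => by
    rw [volume_radialVolume_Ico hn (by positivity), hmt]
    ring_nf
  calc X.norm (s.indicator fun _ => 1)
      ≤ X.norm ((radialVolume n ⁻¹' Ico 0 (k * m)).indicator fun _ => 1) := by
        refine X.norm_indicator_le hn hs (hV measurableSet_Ico) (h.trans ?_)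
        rw [volume_radialVolume_Ico hn le_rfl, hmt, sub_zero, ENNReal.ofReal_mul (by positivity),
          ENNReal.ofReal_natCast]
    _ ≤ X.norm (fun x => ∑ i ∈ Finset.range k, (B i).indicator (fun _ => 1) x) := by
        refine X.mono _ _ (aemeasurable_const.indicator (hV measurableSet_Ico))
          (Finset.aemeasurable_fun_sum _ fun i _ => aemeasurable_const.indicator (hB i))
          (ae_of_all _ fun x => ?_)
        by_cases hx : x ∈ radialVolume n ⁻¹' Ico 0 (k * m)
        swap
        · rw [indicator_of_notMem hx]
          exact zero_le
        rw [indicator_of_mem hx]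
        obtain ⟨h0, h1⟩ : 0 ≤ radialVolume n x ∧ radialVolume n x < k * m := hx
        have hm0 : 0 < m := by
          rcases hm.eq_or_lt with h | h
          · rw [← h, mul_zero] at h1
            exact absurd h1 (not_lt.2 h0)
          · exact h
        set i := ⌊radialVolume n x / m⌋₊
        have hi : i < k := by
          rw [Nat.floor_lt (by positivity), div_lt_iff₀ hm0]
          exact h1
        refine le_trans ?_ (Finset.single_le_sum (f := fun i => (B i).indicator
          (fun _ => (1 : ℝ≥0∞)) x) (fun _ _ => zero_le) (Finset.mem_range.2 hi))
        have : x ∈ B i := ⟨(le_div_iff₀ hm0).1 (Nat.floor_le (by positivity)),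
          (div_lt_iff₀ hm0).1 (Nat.lt_floor_add_one _)⟩
        simp [this]
    _ ≤ ∑ i ∈ Finset.range k, X.norm ((B i).indicator fun _ => 1) :=
        X.norm_sum_le _ _ fun i _ => aemeasurable_const.indicator (hB i)
    _ ≤ ∑ i ∈ Finset.range k, X.norm (t.indicator fun _ => 1) :=
        Finset.sum_le_sum fun i _ => X.norm_indicator_le hn (hB i) ht (hBv i).le
    _ = _ := by simp

/-- Enlarge `s` to a ball of volume k|s| ≥ 2a, whose indicator falls under
`norm_le_tailConstant_mul`. Returning to `s` in the `X`-norm costs the factor k. -/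
theorem norm_indicator_le_tailConstant_mul (hn : 2 ≤ n)
    (X Y : RINorm (volume : Measure (EuclideanSpace ℝ (Fin n)))) {a : ℝ} (ha : 0 < a)
    {s : Set (EuclideanSpace ℝ (Fin n))} (hs : MeasurableSet s) (hfin : volume s ≠ ⊤) (k : ℕ)
    (hk : 1 ≤ k) (hka : ENNReal.ofReal (2 * a) ≤ k * volume s) :
    Y.norm (s.indicator fun _ => 1) ≤
      2 * tailConstant (X.rep hn) (Y.rep hn) a * (k * X.norm (s.indicator fun _ => 1)) := by
  set M := k * (volume s).toReal
  have hM : 0 ≤ M := by positivity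
  have hMs : ENNReal.ofReal M = k * volume s := by
    rw [ENNReal.ofReal_mul (by positivity), ENNReal.ofReal_natCast, ENNReal.ofReal_toReal hfin]
  set t := radialVolume n ⁻¹' Ico 0 M
  have ht : MeasurableSet t := measurable_radialVolume n measurableSet_Ico
  have hvt : volume t = k * volume s := by
    rw [volume_radialVolume_Ico hn le_rfl, sub_zero, hMs]
  have hvfin : volume t < ⊤ := by
    rw [hvt, ← hMs]
    exact ENNReal.ofReal_lt_top
  calc Y.norm (s.indicator fun _ => 1) ≤ Y.norm (t.indicator fun _ => 1) := by
        refine Y.norm_indicator_le hn hs ht ?_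
        rw [hvt]
        exact le_mul_of_one_le_left zero_le (by exact_mod_cast hk)
    _ ≤ 2 * tailConstant (X.rep hn) (Y.rep hn) a * X.norm (t.indicator fun _ => 1) := by
        refine norm_le_tailConstant_mul hn X Y ha (aemeasurable_const.indicator ht)
          (X.indicator_lt_top _ ht hvfin) fun l _ _ => ?_
        rw [distribution_indicator_one]
        split_ifs
        · right
          rwa [hvt]
        · left
          rfl
    _ ≤ _ := by
        gcongr
        exact X.norm_indicator_le_natCast_mul hn ht hs hfin k hvt.le

end RINorm

/-! ### Layer cake formula and Riemann sums of the rearrangement -/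

/-- The layer cake formula. -/
theorem lintegral_eq_lintegral_distribution {α : Type*} [MeasurableSpace α] (μ : Measure α)
    [SFinite μ] {f : α → ℝ≥0∞} (hf : Measurable f) :
    ∫⁻ x, f x ∂μ = ∫⁻ l, distribution μ f (ENNReal.ofReal l) ∂volPos := by
  have hm : MeasurableSet {p : α × ℝ | ENNReal.ofReal p.2 < f p.1} :=
    measurableSet_lt (ENNReal.measurable_ofReal.comp measurable_snd) (hf.comp measurable_fst)
  calc ∫⁻ x, f x ∂μ
      = ∫⁻ x, ∫⁻ l, {p : α × ℝ | ENNReal.ofReal p.2 < f p.1}.indicator (fun _ => (1 : ℝ≥0∞)) (x, l)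
          ∂volPos ∂μ := by
        refine lintegral_congr fun x => ?_
        have : (fun l => {p : α × ℝ | ENNReal.ofReal p.2 < f p.1}.indicator
            (fun _ => (1 : ℝ≥0∞)) (x, l)) = {l : ℝ | ENNReal.ofReal l < f x}.indicator 1 := by
          ext l
          by_cases h : ENNReal.ofReal l < f x <;> simp [h]
        rw [this, lintegral_indicator_one
          (measurableSet_lt ENNReal.measurable_ofReal measurable_const), volPos_lt]
    _ = ∫⁻ l, ∫⁻ x, {p : α × ℝ | ENNReal.ofReal p.2 < f p.1}.indicator (fun _ => (1 : ℝ≥0∞)) (x, l)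
          ∂μ ∂volPos :=
        lintegral_lintegral_swap (measurable_const.indicator hm).aemeasurable
    _ = _ := by
        refine lintegral_congr fun l => ?_
        have : (fun x => {p : α × ℝ | ENNReal.ofReal p.2 < f p.1}.indicator
            (fun _ => (1 : ℝ≥0∞)) (x, l)) = {x | ENNReal.ofReal l < f x}.indicator 1 := by
          ext x
          by_cases h : ENNReal.ofReal l < f x <;> simp [h]
        rw [this, lintegral_indicator_one (measurableSet_lt measurable_const hf)]
        rfl

/-- The sum is δ times the number of points δ, 2δ, …, Nδ below d. With d a value of the distribution
function, it bounds the distribution function of the lower step function of the rearrangement.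
`min_le_sum_ite_mul_lt`, which samples at 0, δ, …, (N-1)δ, is the upper counterpart. -/
theorem sum_ite_succ_mul_lt_le (δ : ℝ) (d : ℝ≥0∞) (N : ℕ) :
    ∑ i ∈ Finset.range N, (if ENNReal.ofReal ((i + 1) * δ) < d then ENNReal.ofReal δ else 0)
      ≤ d := by
  induction N with
  | zero => simp
  | succ N ih =>
    by_cases h : ENNReal.ofReal ((N + 1) * δ) < d
    · calc _ ≤ ∑ i ∈ Finset.range (N + 1), ENNReal.ofReal δ :=
            Finset.sum_le_sum fun i _ => by split_ifs <;> simp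
        _ = ENNReal.ofReal ((N + 1) * δ) := by
            rw [Finset.sum_const, Finset.card_range, nsmul_eq_mul,
              ENNReal.ofReal_mul (by positivity)]
            congr 1
            rw [← Nat.cast_succ, ENNReal.ofReal_natCast]
        _ ≤ d := h.le
    · rw [Finset.sum_range_succ, if_neg h, add_zero]
      exact ih

theorem min_le_sum_ite_mul_lt (δ : ℝ) (d : ℝ≥0∞) (N : ℕ) :
    min d (N * ENNReal.ofReal δ) ≤
      ∑ i ∈ Finset.range N, (if ENNReal.ofReal (i * δ) < d then ENNReal.ofReal δ else 0) := by
  induction N with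
  | zero => simp
  | succ N ih =>
    have e : ENNReal.ofReal (N * δ) = N * ENNReal.ofReal δ := by
      rw [ENNReal.ofReal_mul (by positivity), ENNReal.ofReal_natCast]
    rw [Finset.sum_range_succ]
    by_cases h : ENNReal.ofReal (N * δ) < d
    · rw [if_pos h]
      rw [e] at h
      rw [min_eq_right h.le] at ih
      refine (min_le_right _ _).trans ?_
      rw [Nat.cast_succ, add_mul, one_mul]
      gcongr
    · rw [if_neg h, add_zero]
      rw [not_lt, e] at h
      rw [min_eq_left h] at ih
      exact (min_le_left _ _).trans ih

/-- The integral is bounded by an upper Riemann sum of the nonincreasing rearrangement. -/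
theorem lintegral_le_sum_rearrangement {α : Type*} [MeasurableSpace α] (μ : Measure α)
    [SFinite μ] {f : α → ℝ≥0∞} (hf : Measurable f) (δ : ℝ) (N : ℕ)
    (hN : μ univ ≤ N * ENNReal.ofReal δ) :
    ∫⁻ x, f x ∂μ ≤ ENNReal.ofReal δ * ∑ i ∈ Finset.range N, rearrangement μ f (i * δ) := by
  rw [lintegral_eq_lintegral_distribution μ hf]
  calc ∫⁻ l, distribution μ f (ENNReal.ofReal l) ∂volPos
      ≤ ∫⁻ l, ∑ i ∈ Finset.range N, ENNReal.ofReal δ *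
          {l | ENNReal.ofReal l < rearrangement μ f (i * δ)}.indicator 1 l ∂volPos := by
        refine setLIntegral_mono' measurableSet_Ioi fun l (hl : 0 < l) => ?_
        have h := min_le_sum_ite_mul_lt δ (distribution μ f (ENNReal.ofReal l)) N
        have hd : distribution μ f (ENNReal.ofReal l) ≤ N * ENNReal.ofReal δ :=
          (measure_mono (subset_univ _)).trans hN
        rw [min_eq_left hd] at h
        refine h.trans (Finset.sum_le_sum fun i _ => ?_)
        simp only [← lt_rearrangement_iff μ f (ENNReal.ofReal_pos.2 hl) ENNReal.ofReal_lt_top]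
        by_cases h : ENNReal.ofReal l < rearrangement μ f (i * δ) <;> simp [h]
    _ = _ := by
        have hm : ∀ d : ℝ≥0∞, MeasurableSet {l | ENNReal.ofReal l < d} := fun d =>
          measurableSet_lt ENNReal.measurable_ofReal measurable_const
        rw [lintegral_finsetSum _ fun i _ =>
          (measurable_one.indicator (hm _)).const_mul _, Finset.mul_sum]
        refine Finset.sum_congr rfl fun i _ => ?_
        rw [lintegral_const_mul _ (measurable_one.indicator (hm _)), lintegral_indicator_one (hm _),
          volPos_lt]

theorem distribution_sum_indicator {α ι : Type*} [MeasurableSpace α] (μ : Measure α) [Fintype ι]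
    {B : ι → Set α} (hB : ∀ p, MeasurableSet (B p)) (hd : Pairwise fun p q => Disjoint (B p) (B q))
    (c : ι → ℝ≥0∞) (l : ℝ≥0∞) :
    distribution μ (fun x => ∑ p, (B p).indicator (fun _ => c p) x) l =
      ∑ p, if l < c p then μ (B p) else 0 := by
  classical
  have hval : ∀ p, ∀ x ∈ B p, ∑ q, (B q).indicator (fun _ => c q) x = c p := by
    intro p x hx
    rw [Finset.sum_eq_single p, indicator_of_mem hx]
    · intro q _ hq
      exact indicator_of_notMem (fun h => (hd hq).le_bot ⟨h, hx⟩) _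
    · simp
  have hset : {x | l < ∑ p, (B p).indicator (fun _ => c p) x} =
      ⋃ p ∈ Finset.univ.filter fun p => l < c p, B p := by
    ext x
    simp only [mem_ofPred_eq, mem_iUnion, Finset.mem_filter, Finset.mem_univ, true_and]
    constructor
    · intro hx
      have hne : ∑ p, (B p).indicator (fun _ => c p) x ≠ 0 := (bot_lt_of_lt hx).ne'
      obtain ⟨p, -, hp⟩ := Finset.exists_ne_zero_of_sum_ne_zero hne
      have hxp := mem_of_indicator_ne_zero hp
      rw [hval p x hxp] at hx
      exact ⟨p, hx, hxp⟩
    · rintro ⟨p, hp, hxp⟩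
      rwa [hval p x hxp]
  unfold distribution
  rw [hset, measure_biUnion_finset (fun p _ q _ h => hd h) (fun p _ => hB p), Finset.sum_filter]

/-! ### Averaging does not increase an r.i. norm -/

namespace RINorm

variable {n : ℕ}

/-- Averaging a step function over cells of equal measure does not increase its norm. -/
theorem norm_sum_average_le (hn : 2 ≤ n)
    (X : RINorm (volume : Measure (EuclideanSpace ℝ (Fin n)))) {κ H : Type*} [Fintype κ]
    [Fintype H] [AddCommGroup H] {B : κ × H → Set (EuclideanSpace ℝ (Fin n))}
    (hB : ∀ p, MeasurableSet (B p)) (hd : Pairwise fun p q => Disjoint (B p) (B q))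
    {m : κ → ℝ≥0∞} (hm : ∀ p, volume (B p) = m p.1) (c : κ → H → ℝ≥0∞)
    {g : EuclideanSpace ℝ (Fin n) → ℝ≥0∞} (hg : AEMeasurable g)
    (hdist : ∀ l, 0 < l → l < ⊤ →
      ∑ k, ∑ i, (if l < c k i then m k else 0) ≤ distribution volume g l) :
    X.norm (fun x => ∑ p : κ × H, (B p).indicator
      (fun _ => (Fintype.card H : ℝ≥0∞)⁻¹ * ∑ j, c p.1 j) x) ≤ X.norm g := by
  set N : ℝ≥0∞ := (Fintype.card H : ℝ≥0∞)
  have hN0 : N ≠ 0 := by simp [N]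
  have hN1 : N ≠ ⊤ := ENNReal.natCast_ne_top _
  -- `f j` is the step function with the cells of every block shifted by j. All shifts share one
  -- distribution function, and their mean over j is constant on each block.
  let f : H → EuclideanSpace ℝ (Fin n) → ℝ≥0∞ := fun j x =>
    ∑ p : κ × H, (B p).indicator (fun _ => c p.1 (p.2 + j)) x
  have hf : ∀ j, AEMeasurable (f j) := fun j =>
    Finset.aemeasurable_fun_sum _ fun p _ => aemeasurable_const.indicator (hB p)
  have hfg : ∀ j, X.norm (f j) ≤ X.norm g := fun j => by
    refine X.norm_le_of_distribution_le hn (hf j) hg fun l h0 h1 => le_trans (le_of_eq ?_)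
      (hdist l h0 h1)
    rw [distribution_sum_indicator _ hB hd (fun p => c p.1 (p.2 + j)), Fintype.sum_prod_type]
    refine Finset.sum_congr rfl fun k _ => ?_
    simp only [hm]
    exact Equiv.sum_comp (Equiv.addRight j) fun i => if l < c k i then m k else 0
  have havg : (fun x => ∑ p : κ × H, (B p).indicator (fun _ => N⁻¹ * ∑ j, c p.1 j) x) =
      fun x => N⁻¹ * ∑ j, f j x := by
    ext x
    rw [Finset.sum_comm, Finset.mul_sum]
    refine Finset.sum_congr rfl fun p _ => ?_
    by_cases hx : x ∈ B p
    · simp only [indicator_of_mem hx]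
      rw [← Equiv.sum_comp (Equiv.addLeft p.2)]
      rfl
    · simp [indicator_of_notMem hx]
  rw [havg]
  calc _ ≤ N⁻¹ * X.norm fun x => ∑ j, f j x :=
        X.norm_const_mul_le _ (Finset.aemeasurable_fun_sum _ fun j _ => hf j)
    _ ≤ N⁻¹ * ∑ j : H, X.norm g := by
        gcongr
        exact (X.norm_sum_le _ _ fun j _ => hf j).trans (Finset.sum_le_sum fun j _ => hfg j)
    _ = X.norm g := by
        rw [Finset.sum_const, Finset.card_univ, nsmul_eq_mul, ← mul_assoc,
          ENNReal.inv_mul_cancel hN0 hN1, one_mul]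

end RINorm

/-- The shell `{x : a ≤ ω_n |x|^n < b}`. -/
def volShell (n : ℕ) (a b : ℝ) : Set (EuclideanSpace ℝ (Fin n)) := radialVolume n ⁻¹' Ico a b

theorem measurableSet_volShell (n : ℕ) (a b : ℝ) : MeasurableSet (volShell n a b) :=
  measurable_radialVolume n measurableSet_Ico

theorem volume_volShell {n : ℕ} (hn : 2 ≤ n) {a b : ℝ} (ha : 0 ≤ a) :
    volume (volShell n a b) = ENNReal.ofReal (b - a) :=
  volume_radialVolume_Ico hn ha

/-- The average of `f` over `s`. -/
def lavg {n : ℕ} (f : EuclideanSpace ℝ (Fin n) → ℝ≥0∞) (s : Set (EuclideanSpace ℝ (Fin n))) :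
    ℝ≥0∞ :=
  (volume s)⁻¹ * ∫⁻ x in s, f x

theorem volShell_disjoint {n : ℕ} {v : ℕ → ℝ} (hv : Monotone v) {j k : ℕ} (h : j ≠ k) :
    Disjoint (volShell n (v j) (v (j + 1))) (volShell n (v k) (v (k + 1))) := by
  have := hv.pairwise_disjoint_on_Ico_succ h
  exact this.preimage _

namespace RINorm

variable {n : ℕ}

/-- Split each shell into N cells of equal volume and place on them the lower step values of the
rearrangement of `h` on that shell. This step function has a smaller distribution function than `h`,
so `norm_sum_average_le` applies. Its means fall short of those of `h` by at most M/N, and N tends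
to infinity. -/
theorem norm_sum_lavg_le_of_bounded (hn : 2 ≤ n)
    (X : RINorm (volume : Measure (EuclideanSpace ℝ (Fin n)))) {v : ℕ → ℝ} (hv : StrictMono v)
    (hv0 : 0 ≤ v 0) {h : EuclideanSpace ℝ (Fin n) → ℝ≥0∞} (hh : Measurable h) {M : ℝ≥0∞}
    (hM0 : 0 < M) (hM1 : M < ⊤) (hM : ∀ x, h x ≤ M) (K : ℕ) :
    X.norm (fun x => ∑ k : Fin K, (volShell n (v k) (v (k + 1))).indicator
      (fun _ => lavg h (volShell n (v k) (v (k + 1)))) x) ≤ X.norm h := by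
  set A : ℕ → Set (EuclideanSpace ℝ (Fin n)) := fun k => volShell n (v k) (v (k + 1)) with hA
  have hAm : ∀ k, MeasurableSet (A k) := fun k => measurableSet_volShell n _ _
  have hvn : ∀ k, 0 ≤ v k := fun k => hv0.trans (hv.monotone (Nat.zero_le k))
  have hAv : ∀ k, volume (A k) = ENNReal.ofReal (v (k + 1) - v k) := fun k =>
    volume_volShell hn (hvn k)
  have hpos : ∀ k, 0 < v (k + 1) - v k := fun k => sub_pos.2 (hv (Nat.lt_succ_self k))
  have hAtop : ∀ k, volume (A k) < ⊤ := fun k => by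
    rw [hAv]
    exact ENNReal.ofReal_lt_top
  set T := ∑ k : Fin K, X.norm ((A k).indicator fun _ => 1)
  have hT : T ≠ ⊤ := ENNReal.sum_ne_top.2 fun k _ =>
    (X.indicator_lt_top _ (hAm k) (hAtop k)).ne
  suffices hmain : ∀ N : ℕ, X.norm (fun x => ∑ k : Fin K, (A k).indicator
      (fun _ => lavg h (A k)) x) ≤ X.norm h + M * T / (N + 1 : ℕ) by
    have hlim : Tendsto (fun N : ℕ => X.norm h + M * T / (N + 1 : ℕ)) atTop
        (𝓝 (X.norm h + 0)) := by
      refine tendsto_const_nhds.add ?_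
      have := ENNReal.Tendsto.const_div (a := M * T)
        (ENNReal.tendsto_nat_nhds_top.comp (tendsto_add_atTop_nat 1))
        (Or.inr (ENNReal.mul_ne_top hM1.ne hT))
      simpa using this
    rw [add_zero] at hlim
    exact ge_of_tendsto' hlim hmain
  -- The number of cells is N' + 1, so that it is never zero.
  intro N'
  set N := N' + 1
  have hN : (0 : ℝ) < N := by positivity
  let δ : ℕ → ℝ := fun k => (v (k + 1) - v k) / N
  have hδ : ∀ k, 0 < δ k := fun k => div_pos (hpos k) hN
  have hNδ : ∀ k, N * δ k = v (k + 1) - v k := fun k => by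
    simp only [δ]
    field_simp
  let r : ℕ → ℝ → ℝ≥0∞ := fun k => rearrangement (volume.restrict (A k)) h
  let B : Fin K × Fin N → Set (EuclideanSpace ℝ (Fin n)) := fun p =>
    volShell n (v p.1 + p.2 * δ p.1) (v p.1 + (p.2 + 1) * δ p.1)
  have hBm : ∀ p, MeasurableSet (B p) := fun p => measurableSet_volShell n _ _
  have hBA : ∀ p, B p ⊆ A p.1 := by
    rintro ⟨k, i⟩ x ⟨h0, h1⟩
    have hi : ((i : ℕ) + 1 : ℝ) ≤ N := by exact_mod_cast i.2
    have h2 : ((i : ℕ) + 1) * δ k ≤ N * δ k := by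
      gcongr
      exact (hδ _).le
    have h3 : 0 ≤ (i : ℕ) * δ k := mul_nonneg (by positivity) (hδ _).le
    rw [hNδ] at h2
    simp only at h0 h1
    exact ⟨by linarith, by linarith⟩
  have hBd : Pairwise fun p q => Disjoint (B p) (B q) := by
    rintro ⟨k, i⟩ ⟨k', i'⟩ hne
    by_cases hk : k = k'
    · subst hk
      have hi : (i : ℕ) ≠ i' := fun e => hne (by rw [Fin.ext e])
      have hmono : Monotone fun j : ℕ => v k + j * δ k := fun a b hab => by
        have : (a : ℝ) ≤ b := by exact_mod_cast hab
        have := mul_le_mul_of_nonneg_right this (hδ k).le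
        simp only
        linarith
      have := volShell_disjoint (n := n) hmono hi
      simpa [B] using this
    · refine (volShell_disjoint hv.monotone (fun e => hk (Fin.ext e))).mono (hBA (k, i))
        (hBA (k', i'))
  have hBv : ∀ p, volume (B p) = ENNReal.ofReal (δ p.1) := fun p => by
    rw [volume_volShell hn (add_nonneg (hvn _) (mul_nonneg (by positivity) (hδ _).le))]
    ring_nf
  have hcover : ∀ k : Fin K, ∀ x ∈ A k, ∃ i, x ∈ B (k, i) := by
    rintro k x ⟨h0, h1⟩
    set t := (radialVolume n x - v k) / δ k with ht
    have ht0 : 0 ≤ t := div_nonneg (by linarith) (hδ k).le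
    have ht1 : t < N := by
      rw [ht, div_lt_iff₀ (hδ k), hNδ]
      linarith
    refine ⟨⟨⌊t⌋₊, (Nat.floor_lt ht0).2 ht1⟩, ?_, ?_⟩
    · have := (le_div_iff₀ (hδ k)).1 (Nat.floor_le ht0)
      simp only
      linarith
    · have := (div_lt_iff₀ (hδ k)).1 (Nat.lt_floor_add_one t)
      simp only
      linarith
  have hstep := X.norm_sum_average_le hn hBm hBd (m := fun k => ENNReal.ofReal (δ k)) hBv
    (fun k i => r k ((i + 1 : ℕ) * δ k)) hh.aemeasurable fun l h0 h1 => by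
      calc ∑ k : Fin K, ∑ i : Fin N, (if l < r k ((i + 1 : ℕ) * δ k)
            then ENNReal.ofReal (δ k) else 0)
          ≤ ∑ k : Fin K, volume ({x | l < h x} ∩ A k) := by
            refine Finset.sum_le_sum fun k _ => ?_
            have := sum_ite_succ_mul_lt_le (δ k)
              (distribution (volume.restrict (A k)) h l) N
            rw [Finset.sum_range] at this
            simp only [r, lt_rearrangement_iff _ _ h0 h1, Nat.cast_add, Nat.cast_one]
            refine this.trans (le_of_eq ?_)
            exact Measure.restrict_apply (measurableSet_lt measurable_const hh)
        _ = volume (⋃ k : Fin K, {x | l < h x} ∩ A k) := by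
            have hd : Pairwise fun j k : Fin K =>
                Disjoint ({x | l < h x} ∩ A j) ({x | l < h x} ∩ A k) := fun j k hjk =>
              (volShell_disjoint hv.monotone (fun e => hjk (Fin.ext e))).mono
                inter_subset_right inter_subset_right
            rw [measure_iUnion hd fun k => (measurableSet_lt measurable_const hh).inter (hAm k),
              tsum_fintype]
        _ ≤ distribution volume h l :=
            measure_mono (iUnion_subset fun k => inter_subset_left)
  have hrM : ∀ k, r k 0 ≤ M := fun k => by
    refine sInf_le ⟨hM0, hM1, ?_⟩
    have : {x | M < h x} = ∅ := by
      ext x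
      simp [hM x]
    simp [distribution, this]
  -- Upper and lower Riemann sums differ by an index shift, so one extra term `r k 0` ≤ M appears.
  -- Divided by N it gives the error M/N.
  have havg : ∀ k, lavg h (A k) ≤ (N : ℝ≥0∞)⁻¹ * ∑ i : Fin N, r k ((i + 1 : ℕ) * δ k)
      + M / N := by
    intro k
    have hmu : (volume.restrict (A k)) univ = N * ENNReal.ofReal (δ k) := by
      rw [Measure.restrict_apply_univ, hAv, ← hNδ, ENNReal.ofReal_mul hN.le, ENNReal.ofReal_natCast]
    have h1 := lintegral_le_sum_rearrangement (volume.restrict (A k)) hh (δ k) N hmu.le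
    rw [Measure.restrict_apply_univ] at hmu
    have hδ0 : ENNReal.ofReal (δ k) ≠ 0 := (ENNReal.ofReal_pos.2 (hδ k)).ne'
    calc lavg h (A k) ≤ (volume (A k))⁻¹ * (ENNReal.ofReal (δ k) *
            ∑ i ∈ Finset.range N, r k (i * δ k)) := by
          unfold lavg
          gcongr
      _ = (N : ℝ≥0∞)⁻¹ * ∑ i ∈ Finset.range N, r k (i * δ k) := by
          rw [hmu, ENNReal.mul_inv (Or.inr ENNReal.ofReal_ne_top) (Or.inr hδ0), ← mul_assoc,
            mul_assoc (N : ℝ≥0∞)⁻¹, ENNReal.inv_mul_cancel hδ0 ENNReal.ofReal_ne_top, mul_one]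
      _ ≤ (N : ℝ≥0∞)⁻¹ * (∑ i : Fin N, r k ((i + 1 : ℕ) * δ k) + M) := by
          gcongr
          calc ∑ i ∈ Finset.range N, r k (i * δ k)
              ≤ ∑ i ∈ Finset.range (N + 1), r k (i * δ k) :=
                Finset.sum_le_sum_of_subset (Finset.range_subset_range.2 (Nat.le_succ N))
            _ = ∑ i ∈ Finset.range N, r k ((i + 1 : ℕ) * δ k) + r k 0 := by
                rw [Finset.sum_range_succ']
                simp
            _ ≤ _ := by
                rw [Finset.sum_range]
                gcongr
                exact hrM k
      _ = _ := by rw [mul_add, ENNReal.div_eq_inv_mul]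
  set F : EuclideanSpace ℝ (Fin n) → ℝ≥0∞ := fun x => ∑ p : Fin K × Fin N, (B p).indicator
      (fun _ => (Fintype.card (Fin N) : ℝ≥0∞)⁻¹ * ∑ j : Fin N, r p.1 ((j + 1 : ℕ) * δ p.1)) x
    with hF
  have hFm : AEMeasurable F :=
    Finset.aemeasurable_fun_sum _ fun p _ => aemeasurable_const.indicator (hBm p)
  have hS : ∀ c : ℕ → ℝ≥0∞, AEMeasurable fun x => ∑ k : Fin K, (A k).indicator (fun _ => c k) x :=
    fun c => Finset.aemeasurable_fun_sum _ fun k _ => aemeasurable_const.indicator (hAm k)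
  have hAsum : ∀ (c : ℕ → ℝ≥0∞) (k : Fin K), ∀ x ∈ A k,
      ∑ k : Fin K, (A k).indicator (fun _ => c k) x = c k := fun c k x hx => by
    rw [Finset.sum_eq_single k, indicator_of_mem hx]
    · intro q _ hq
      exact indicator_of_notMem (fun h => (volShell_disjoint hv.monotone
        (fun e => hq (Fin.ext e))).le_bot ⟨h, hx⟩) _
    · simp
  calc X.norm (fun x => ∑ k : Fin K, (A k).indicator (fun _ => lavg h (A k)) x)
      ≤ X.norm (fun x => F x + ∑ k : Fin K, (A k).indicator (fun _ => M / N) x) := by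
        refine X.mono _ _ (hS fun k => lavg h (A k)) (hFm.add (hS fun _ => M / N))
          (ae_of_all _ fun x => ?_)
        by_cases hx : ∃ k : Fin K, x ∈ A k
        · obtain ⟨k, hk⟩ := hx
          obtain ⟨i, hi⟩ := hcover k x hk
          rw [hAsum (fun k => lavg h (A k)) k x hk, hAsum (fun _ => M / N) k x hk]
          refine (havg k).trans (add_le_add ?_ le_rfl)
          refine le_trans ?_ (Finset.single_le_sum (fun _ _ => zero_le) (Finset.mem_univ (k, i)))
          rw [indicator_of_mem hi, Fintype.card_fin]
        · simp only [not_exists] at hx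
          rw [Finset.sum_eq_zero fun k _ => indicator_of_notMem (hx k) _]
          exact zero_le
    _ ≤ X.norm F + X.norm (fun x => ∑ k : Fin K, (A k).indicator (fun _ => M / N) x) :=
        X.add_le _ _ hFm (hS fun _ => M / N)
    _ ≤ X.norm h + M / N * T := by
        refine add_le_add hstep ((X.norm_sum_le _ (fun (k : Fin K) => (A k).indicator fun _ => M / N)
          fun k _ => aemeasurable_const.indicator (hAm k)).trans (le_of_eq ?_))
        rw [Finset.mul_sum]
        refine Finset.sum_congr rfl fun k _ => ?_
        exact X.norm_indicator_const (ENNReal.div_ne_top hM1.ne (by simp [N])) (hAm k)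
    _ = _ := by
        rw [ENNReal.mul_div_right_comm]

/-- Averaging over shells does not increase an r.i. norm. -/
theorem norm_iSup_lavg_le (hn : 2 ≤ n)
    (X : RINorm (volume : Measure (EuclideanSpace ℝ (Fin n)))) {v : ℕ → ℝ} (hv : StrictMono v)
    (hv0 : 0 ≤ v 0) {h : EuclideanSpace ℝ (Fin n) → ℝ≥0∞} (hh : Measurable h) :
    X.norm (fun x => ⨆ k, (volShell n (v k) (v (k + 1))).indicator
      (fun _ => lavg h (volShell n (v k) (v (k + 1)))) x) ≤ X.norm h := by
  set A : ℕ → Set (EuclideanSpace ℝ (Fin n)) := fun k => volShell n (v k) (v (k + 1)) with hA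
  have hAm : ∀ k, MeasurableSet (A k) := fun k => measurableSet_volShell n _ _
  have hd : ∀ j k x, x ∈ A k → j ≠ k → x ∉ A j := fun j k x hk hjk hj =>
    (volShell_disjoint hv.monotone hjk).le_bot ⟨hj, hk⟩
  -- Truncation at height m + 1 rather than m keeps the bound positive, as
  -- `norm_sum_lavg_le_of_bounded` requires.
  let g : ℕ → EuclideanSpace ℝ (Fin n) → ℝ≥0∞ := fun m x => min (h x) (m + 1 : ℕ)
  have hg : ∀ m, Measurable (g m) := fun m => hh.min measurable_const
  have hgmono : Monotone g := fun i j hij x => min_le_min le_rfl (by gcongr)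
  have hgsup : ∀ x, ⨆ m, g m x = h x := fun x => by
    refine le_antisymm (iSup_le fun m => min_le_left _ _) (le_of_forall_lt fun c hc => ?_)
    obtain ⟨m, hm⟩ := ENNReal.exists_nat_gt (ne_top_of_lt hc)
    exact lt_iSup_iff.2 ⟨m, lt_min hc (hm.trans_le (by exact_mod_cast Nat.le_succ m))⟩
  have hlmono : ∀ k, Monotone fun m => lavg (g m) (A k) := fun k i j hij => by
    simp only [lavg]
    gcongr
    exact hgmono hij _
  have hlsup : ∀ k, ⨆ m, lavg (g m) (A k) = lavg h (A k) := fun k => by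
    simp only [lavg]
    rw [← ENNReal.mul_iSup, ← lintegral_iSup hg hgmono]
    simp only [hgsup]
  -- The truncation height and the number of shells grow together, so one use of the monotone
  -- convergence axiom `iSup_eq` suffices.
  let F : ℕ → EuclideanSpace ℝ (Fin n) → ℝ≥0∞ := fun m x =>
    ∑ k : Fin m, (A k).indicator (fun _ => lavg (g m) (A k)) x
  have hF0 : ∀ m x, (∀ k, x ∉ A k) → F m x = 0 := fun m x hx =>
    Finset.sum_eq_zero fun k _ => indicator_of_notMem (hx k) _
  have hF : ∀ m k x, x ∈ A k → F m x = if k < m then lavg (g m) (A k) else 0 := by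
    intro m k x hx
    split_ifs with hk
    · simp only [F]
      rw [Finset.sum_eq_single ⟨k, hk⟩, indicator_of_mem hx]
      · intro q _ hq
        exact indicator_of_notMem (hd _ _ x hx fun e => hq (Fin.ext e)) _
      · simp
    · exact Finset.sum_eq_zero fun q _ =>
        indicator_of_notMem (hd _ _ x hx fun e => hk (by omega)) _
  have key := X.iSup_eq F (fun x => ⨆ k, (A k).indicator (fun _ => lavg h (A k)) x)
    (fun m => Finset.aemeasurable_fun_sum _ fun k _ => aemeasurable_const.indicator (hAm k))
    (AEMeasurable.iSup fun k => aemeasurable_const.indicator (hAm k)) (ae_of_all _ fun x => by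
      by_cases hx : ∃ k, x ∈ A k
      · obtain ⟨k, hk⟩ := hx
        constructor
        · intro i j hij
          simp only [hF _ k x hk]
          split_ifs
          · exact hlmono k hij
          · omega
          · exact zero_le
          · exact zero_le
        · have e : ⨆ j, (A j).indicator (fun _ => lavg h (A j)) x = lavg h (A k) := by
            refine le_antisymm (iSup_le fun j => ?_) (le_iSup_of_le k ?_)
            swap
            · rw [indicator_of_mem hk]
            rcases eq_or_ne j k with rfl | hj
            · exact (indicator_of_mem hk _).le
            · rw [indicator_of_notMem (hd j k x hk hj)]
              exact zero_le
          rw [e, ← hlsup]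
          refine le_antisymm (iSup_mono fun m => ?_) (iSup_le fun m => ?_)
          · rw [hF _ k x hk]
            split_ifs
            exacts [le_rfl, zero_le]
          · refine le_iSup_of_le (max m (k + 1)) ?_
            rw [hF _ k x hk, if_pos (by omega)]
            exact hlmono k (le_max_left _ _)
      · simp only [not_exists] at hx
        simp only [hF0 _ x hx, iSup_const]
        refine ⟨monotone_const, (le_antisymm (iSup_le fun k =>
          (indicator_of_notMem (hx k) _).le) zero_le).symm⟩)
  rw [← key]
  refine iSup_le fun m => ?_
  refine (X.norm_sum_lavg_le_of_bounded hn hv hv0 (hg m) (M := (m + 1 : ℕ)) (by simp)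
    (ENNReal.natCast_lt_top _) (fun x => min_le_right _ _) m).trans ?_
  exact X.mono _ _ (hg m).aemeasurable hh.aemeasurable (ae_of_all _ fun x => min_le_left _ _)

/-- The norm of the average over a single shell. -/
theorem lavg_mul_norm_indicator_le (hn : 2 ≤ n)
    (X : RINorm (volume : Measure (EuclideanSpace ℝ (Fin n)))) {b : ℝ} (hb : 0 < b)
    {h : EuclideanSpace ℝ (Fin n) → ℝ≥0∞} (hh : Measurable h) (hfin : lavg h (volShell n 0 b) ≠ ⊤) :
    lavg h (volShell n 0 b) * X.norm ((volShell n 0 b).indicator fun _ => 1) ≤ X.norm h := by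
  -- The ball is the shell of index 0 for the sequence kb; the other shells are discarded.
  have hv : StrictMono fun k : ℕ => k * b := fun i j hij => by
    have : (i : ℝ) < j := by exact_mod_cast hij
    exact mul_lt_mul_of_pos_right this hb
  refine le_trans ?_ (X.norm_iSup_lavg_le hn hv (by simp) hh)
  rw [← X.norm_indicator_const hfin (measurableSet_volShell n 0 b)]
  refine X.mono _ _ (aemeasurable_const.indicator (measurableSet_volShell n 0 b))
    (AEMeasurable.iSup fun k => aemeasurable_const.indicator (measurableSet_volShell n _ _))
    (ae_of_all _ fun x => le_iSup_of_le 0 ?_)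
  simp

end RINorm

/-! ### Radial functions in the volume coordinate -/

/-- The volume of the unit ball of `ℝⁿ`. -/
def ballVolume (n : ℕ) : ℝ := (volume (Metric.ball (0 : EuclideanSpace ℝ (Fin n)) 1)).toReal

theorem ballVolume_pos (n : ℕ) : 0 < ballVolume n :=
  ENNReal.toReal_pos (Metric.measure_ball_pos _ _ one_pos).ne' measure_ball_lt_top.ne

theorem radialVolume_eq (n : ℕ) (x : EuclideanSpace ℝ (Fin n)) :
    radialVolume n x = ballVolume n * ‖x‖ ^ n := rfl

theorem radialVolume_nonneg (n : ℕ) (x : EuclideanSpace ℝ (Fin n)) : 0 ≤ radialVolume n x :=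
  mul_nonneg (ballVolume_pos n).le (by positivity)

theorem continuous_radialVolume (n : ℕ) : Continuous (radialVolume n) := by
  unfold radialVolume
  fun_prop

/-- A measurable function that is a.e. a function of the norm is a.e. a measurable function of the
norm. -/
theorem exists_measurable_comp_norm {E : Type*} [NormedAddCommGroup E] [NormedSpace ℝ E]
    [FiniteDimensional ℝ E] [Nontrivial E] [MeasurableSpace E] [BorelSpace E] (μ : Measure E)
    [μ.IsAddHaarMeasure] {u : E → ℝ} (hu : AEMeasurable u μ) {g : ℝ → ℝ}
    (hg : ∀ᵐ x ∂μ, u x = g ‖x‖) :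
    ∃ γ : ℝ → ℝ, Measurable γ ∧ ∀ᵐ x ∂μ, u x = γ ‖x‖ := by
  set w := hu.mk u
  have hw : Measurable w := hu.measurable_mk
  have h1 : ∀ᵐ x ∂μ, w x = g ‖x‖ := by
    filter_upwards [hg, hu.ae_eq_mk] with x h2 h3
    rw [← h2, h3]
  have hemb : MeasurableEmbedding (Subtype.val : ({0}ᶜ : Set E) → E) :=
    MeasurableEmbedding.subtype_coe (measurableSet_singleton _).compl
  have hT := μ.measurePreserving_homeomorphUnitSphereProd
  set T := homeomorphUnitSphereProd E
  set ν := Measure.volumeIoiPow (Module.finrank ℝ E - 1)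
  have hT' : MeasurePreserving T.symm (μ.toSphere.prod ν) (μ.comap Subtype.val) :=
    hT.symm (e := T.toMeasurableEquiv)
  have hcomap : ∀ᵐ y : ({0}ᶜ : Set E) ∂(μ.comap Subtype.val), w y = g ‖(y : E)‖ := by
    have := (hemb.ae_map_iff (p := fun x => w x = g ‖x‖) (μ := μ.comap Subtype.val)).1
    rw [hemb.map_comap] at this
    exact this (ae_restrict_of_ae h1)
  have h2 : ∀ᵐ p ∂(μ.toSphere.prod ν), w (p.2.1 • p.1.1) = g p.2.1 := by
    filter_upwards [hT'.quasiMeasurePreserving.ae hcomap] with p hp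
    have e : ((T.symm p : ({0}ᶜ : Set E)) : E) = p.2.1 • p.1.1 := by simp [T]
    rw [e, norm_smul, norm_eq_of_mem_sphere, mul_one, Real.norm_of_nonneg p.2.2.out.le] at hp
    exact hp
  -- The profile `g` need not be measurable. Fubini in polar coordinates yields a direction θ with
  -- w(rθ) = g(r) for a.e. r, and r ↦ w(rθ) is a measurable replacement.
  have h3 := Measure.ae_ae_of_ae_prod h2
  have : NeZero μ.toSphere := ⟨Measure.toSphere_ne_zero _⟩
  obtain ⟨θ, hθ⟩ := h3.exists
  have h4 : ∀ᵐ p ∂(μ.toSphere.prod ν), w (p.2.1 • θ.1) = g p.2.1 :=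
    Measure.quasiMeasurePreserving_snd.ae hθ
  have h5 : ∀ᵐ y : ({0}ᶜ : Set E) ∂(μ.comap Subtype.val),
      w (‖(y : E)‖ • θ.1) = g ‖(y : E)‖ := by
    filter_upwards [hT.quasiMeasurePreserving.ae h4] with y hy
    simpa [T] using hy
  have h6 : ∀ᵐ x ∂μ, w (‖x‖ • θ.1) = g ‖x‖ := by
    have := (hemb.ae_map_iff (p := fun x : E => w (‖x‖ • θ.1) = g ‖x‖)
      (μ := μ.comap Subtype.val)).2 h5
    rw [hemb.map_comap, Subtype.range_coe] at this
    rwa [Measure.restrict_eq_self_of_ae_mem] at this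
    exact compl_mem_ae_iff.2 (by simp)
  refine ⟨fun r => w (r • θ.1), hw.comp (by fun_prop), ?_⟩
  filter_upwards [h6, hg] with x h7 h8
  rw [h7, h8]

/-- A measurable radial function is a.e. a measurable function of `ω_n |x|^n`. -/
theorem IsRadial.exists_measurable {n : ℕ} (hn : 2 ≤ n) {u : EuclideanSpace ℝ (Fin n) → ℝ}
    (h : IsRadial u) (hu : AEMeasurable u) :
    ∃ γ : ℝ → ℝ, Measurable γ ∧ ∀ᵐ x, u x = γ (radialVolume n x) := by
  obtain ⟨g, hg⟩ := h
  have : Nonempty (Fin n) := ⟨⟨0, by omega⟩⟩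
  obtain ⟨γ, hγ, h⟩ := exists_measurable_comp_norm volume hu hg
  refine ⟨fun v => γ ((v / ballVolume n) ^ ((n : ℝ)⁻¹)), hγ.comp (by fun_prop), ?_⟩
  filter_upwards [h] with x hx
  rw [hx, radialVolume_eq, mul_div_cancel_left₀ _ (ballVolume_pos n).ne',
    Real.pow_rpow_inv_natCast (norm_nonneg x) (by omega)]

/-! ### Radial test fields and their divergence -/

section Divergence

variable {n : ℕ} {θ : ℝ → ℝ} {c d : ℝ}

/-- Vanishing of θ up to c > 0 makes the composite zero near the origin, the only point where the
norm is not smooth. -/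
theorem contDiff_comp_radialVolume (hn : 2 ≤ n) (hθ : ContDiff ℝ ∞ θ) (hc : 0 < c)
    (hc' : ∀ v ≤ c, θ v = 0) : ContDiff ℝ ∞ fun y => θ (radialVolume n y) := by
  rw [contDiff_iff_contDiffAt]
  intro y
  by_cases hy : y = 0
  · have h0 : radialVolume n y < c := by
      rw [hy, radialVolume_eq, norm_zero, zero_pow (by omega), mul_zero]
      exact hc
    have : (fun y => θ (radialVolume n y)) =ᶠ[𝓝 y] fun _ => 0 := by
      filter_upwards [(continuous_radialVolume n).continuousAt.eventually_lt_const h0] with z hz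
      exact hc' _ hz.le
    exact contDiffAt_const.congr_of_eventuallyEq this
  · refine hθ.contDiffAt.comp y ?_
    exact contDiffAt_const.mul ((contDiffAt_norm ℝ hy).pow n)

theorem hasCompactSupport_comp_radialVolume (hn : 2 ≤ n) (hd' : ∀ v, d ≤ v → θ v = 0) :
    HasCompactSupport fun y => θ (radialVolume n y) := by
  refine HasCompactSupport.intro (isCompact_closedBall 0 (max 1 (d / ballVolume n)))
    fun y hy => hd' _ ?_
  rw [mem_closedBall_zero_iff, not_le, max_lt_iff, div_lt_iff₀ (ballVolume_pos n)] at hy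
  rw [radialVolume_eq, mul_comm]
  refine hy.2.le.trans ?_
  gcongr
  · exact (ballVolume_pos n).le
  · exact le_self_pow₀ hy.1.le (by omega)

/-- Euler's identity: `radialVolume` is homogeneous of degree n, so differentiate along t ↦ t • y at
t = 1 in two ways. -/
theorem fderiv_comp_radialVolume_self (hn : 2 ≤ n) (hθ : ContDiff ℝ ∞ θ) (hc : 0 < c)
    (hc' : ∀ v ≤ c, θ v = 0) (y : EuclideanSpace ℝ (Fin n)) :
    fderiv ℝ (fun y => θ (radialVolume n y)) y y =
      n * radialVolume n y * deriv θ (radialVolume n y) := by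
  have h1 : HasDerivAt (fun t : ℝ => θ (radialVolume n (t • y)))
      (fderiv ℝ (fun y => θ (radialVolume n y)) y y) 1 := by
    have hd := ((contDiff_comp_radialVolume hn hθ hc hc').differentiable (by simp) y).hasFDerivAt
    have hs : HasDerivAt (fun t : ℝ => t • y) y 1 := by
      simpa using (hasDerivAt_id (1 : ℝ)).smul_const y
    have hd' : HasFDerivAt (fun y => θ (radialVolume n y))
      (fderiv ℝ (fun y => θ (radialVolume n y)) y) ((1 : ℝ) • y) := by rwa [one_smul]
    exact hd'.comp_hasDerivAt (1 : ℝ) hs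
  have h2 : HasDerivAt (fun t : ℝ => θ (t ^ n * radialVolume n y))
      (deriv θ (radialVolume n y) * (n * radialVolume n y)) 1 := by
    have hs : HasDerivAt (fun t : ℝ => t ^ n * radialVolume n y) (n * radialVolume n y) 1 := by
      simpa using (hasDerivAt_pow n (1 : ℝ)).mul_const (radialVolume n y)
    have hd : HasDerivAt θ (deriv θ (radialVolume n y)) ((1 : ℝ) ^ n * radialVolume n y) := by
      rw [one_pow, one_mul]
      exact (hθ.differentiable (by simp) _).hasDerivAt
    exact hd.comp (1 : ℝ) hs
  have h3 : (fun t : ℝ => θ (radialVolume n (t • y))) =ᶠ[𝓝 1]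
      fun t : ℝ => θ (t ^ n * radialVolume n y) := by
    filter_upwards [lt_mem_nhds (zero_lt_one' ℝ)] with t ht
    rw [radialVolume_eq, radialVolume_eq, norm_smul, Real.norm_of_nonneg ht.le, mul_pow]
    ring_nf
  rw [h1.unique (h2.congr_of_eventuallyEq h3)]
  ring

/-- The divergence of the radial field `θ(ω_n |y|^n) y`. -/
theorem sum_fderiv_radial_field (hn : 2 ≤ n) (hθ : ContDiff ℝ ∞ θ) (hc : 0 < c)
    (hc' : ∀ v ≤ c, θ v = 0) (y : EuclideanSpace ℝ (Fin n)) :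
    ∑ i, fderiv ℝ (fun y : EuclideanSpace ℝ (Fin n) => θ (radialVolume n y) * y i) y
      (EuclideanSpace.single i 1) = n * deriv (fun v => v * θ v) (radialVolume n y) := by
  have hd := (contDiff_comp_radialVolume hn hθ hc hc').differentiable (by simp) y
  have hi : ∀ i, fderiv ℝ (fun y : EuclideanSpace ℝ (Fin n) => θ (radialVolume n y) * y i) y
      (EuclideanSpace.single i 1) = θ (radialVolume n y) +
      fderiv ℝ (fun y => θ (radialVolume n y)) y (y i • EuclideanSpace.single i 1) := by
    intro i
    have hp : HasFDerivAt (fun y : EuclideanSpace ℝ (Fin n) => y i)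
      (EuclideanSpace.proj i : EuclideanSpace ℝ (Fin n) →L[ℝ] ℝ) y :=
      (EuclideanSpace.proj i : EuclideanSpace ℝ (Fin n) →L[ℝ] ℝ).hasFDerivAt
    rw [(hd.hasFDerivAt.fun_mul hp).fderiv]
    simp
  have hy : ∑ i, y i • EuclideanSpace.single i (1 : ℝ) = y := by
    have := (EuclideanSpace.basisFun (Fin n) ℝ).sum_repr y
    simpa using this
  have hθd := (hθ.differentiable (by simp) (radialVolume n y)).hasDerivAt
  -- With ψ = θ(V), div(ψy) = nψ + ∇ψ·y, and the last term is nVθ'(V).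
  simp_rw [hi]
  rw [Finset.sum_add_distrib, ← map_sum, hy, fderiv_comp_radialVolume_self hn hθ hc hc',
    ((hasDerivAt_id' _).fun_mul hθd).deriv]
  simp
  ring

end Divergence

/-- The weak gradient tested against the radial field `θ(ω_n |y|^n) y`. -/
theorem HasWeakGradient.integral_radial_field {n : ℕ} (hn : 2 ≤ n)
    {u : EuclideanSpace ℝ (Fin n) → ℝ} {G : EuclideanSpace ℝ (Fin n) → EuclideanSpace ℝ (Fin n)}
    (h : HasWeakGradient u G) {θ : ℝ → ℝ} {c d : ℝ} (hθ : ContDiff ℝ ∞ θ) (hc : 0 < c)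
    (hc' : ∀ v ≤ c, θ v = 0) (hd' : ∀ v, d ≤ v → θ v = 0) :
    ∫ y, u y * (n * deriv (fun v => v * θ v) (radialVolume n y)) =
      -∫ y, inner ℝ (G y) y * θ (radialVolume n y) := by
  obtain ⟨hu, hG, hw⟩ := h
  have hψ := contDiff_comp_radialVolume hn hθ hc hc'
  have hψc : HasCompactSupport fun y => θ (radialVolume n y) :=
    hasCompactSupport_comp_radialVolume hn hd'
  let φ : Fin n → EuclideanSpace ℝ (Fin n) → ℝ := fun i y => θ (radialVolume n y) * y i
  have hφ : ∀ i, ContDiff ℝ ∞ (φ i) := fun i =>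
    hψ.mul (EuclideanSpace.proj i : EuclideanSpace ℝ (Fin n) →L[ℝ] ℝ).contDiff
  have hφc : ∀ i, HasCompactSupport (φ i) := fun i => hψc.mul_right
  have h1 : ∀ i, Integrable fun y => u y * fderiv ℝ (φ i) y (EuclideanSpace.single i 1) := by
    intro i
    refine hu.integrable_smul_right_of_hasCompactSupport
      (((hφ i).continuous_fderiv (by simp)).clm_apply continuous_const) ?_
    exact (hφc i).fderiv_apply ℝ _
  have h2 : ∀ i, Integrable fun y => G y i * φ i y := by
    intro i
    have hGi : LocallyIntegrable fun y => G y i := fun x => by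
      obtain ⟨s, hs, h⟩ := hG x
      exact ⟨s, hs, (EuclideanSpace.proj i : EuclideanSpace ℝ (Fin n) →L[ℝ] ℝ).integrable_comp h⟩
    exact hGi.integrable_smul_right_of_hasCompactSupport (hφ i).continuous (hφc i)
  calc ∫ y, u y * (n * deriv (fun v => v * θ v) (radialVolume n y))
      = ∫ y, ∑ i, u y * fderiv ℝ (φ i) y (EuclideanSpace.single i 1) := by
        refine integral_congr_ae (ae_of_all _ fun y => ?_)
        simp only
        rw [← Finset.mul_sum, sum_fderiv_radial_field hn hθ hc hc']
    _ = ∑ i, -∫ y, G y i * φ i y := by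
        rw [integral_finsetSum _ fun i _ => h1 i]
        exact Finset.sum_congr rfl fun i _ => hw _ (hφ i) (hφc i) i
    _ = _ := by
        rw [Finset.sum_neg_distrib, ← integral_finsetSum _ fun i _ => h2 i]
        congr 1
        refine integral_congr_ae (ae_of_all _ fun y => ?_)
        simp only [φ, PiLp.inner_apply, Finset.sum_mul]
        refine Finset.sum_congr rfl fun i _ => ?_
        simp only [RCLike.inner_apply, conj_trivial]
        ring

/-! ### Oscillation of radial Sobolev functions on shells -/

/-- The oscillation bound `n⁻¹ ∫ |G(y)| |y| / (ω_n |y|^n) dy` over the shell between `a` and `b`. -/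
def shellOsc {n : ℕ} (G : EuclideanSpace ℝ (Fin n) → EuclideanSpace ℝ (Fin n)) (a b : ℝ) : ℝ≥0∞ :=
  (n : ℝ≥0∞)⁻¹ * ∫⁻ y in volShell n a b, ‖G y‖ₑ * ENNReal.ofReal (‖y‖ / radialVolume n y)

/-- Zero mean is what makes the primitive vanish beyond d. For a difference of two probability
densities it yields a compactly supported profile for the radial field. -/
theorem integral_zero_primitive {ζ : ℝ → ℝ} (hζ : ContDiff ℝ ∞ ζ) {c d : ℝ} (hcd : c ≤ d)
    (hc : ∀ v ≤ c, ζ v = 0) (hd : ∀ v, d ≤ v → ζ v = 0) (h0 : ∫ v, ζ v = 0) :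
    ContDiff ℝ ∞ (fun v => ∫ t in c..v, ζ t) ∧ (∀ v, HasDerivAt (fun v => ∫ t in c..v, ζ t) (ζ v) v)
      ∧ (∀ v ≤ c, ∫ t in c..v, ζ t = 0) ∧ ∀ v, d ≤ v → ∫ t in c..v, ζ t = 0 := by
  have hderiv : ∀ v, HasDerivAt (fun v => ∫ t in c..v, ζ t) (ζ v) v := fun v =>
    hζ.continuous.integral_hasStrictDerivAt c v |>.hasDerivAt
  refine ⟨?_, hderiv, ?_, ?_⟩
  · rw [contDiff_infty_iff_deriv]
    refine ⟨fun v => (hderiv v).differentiableAt, ?_⟩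
    rwa [funext fun v => (hderiv v).deriv]
  · intro v hv
    rw [intervalIntegral.integral_symm, intervalIntegral.integral_of_le hv,
      setIntegral_eq_zero_of_forall_eq_zero, neg_zero]
    exact fun t ht => hc t ht.2
  · intro v hv
    rw [intervalIntegral.integral_of_le (hcd.trans hv),
      setIntegral_eq_integral_of_forall_compl_eq_zero, h0]
    intro t ht
    rw [mem_Ioc, not_and_or, not_lt, not_le] at ht
    rcases ht with h | h
    · exact hc t h
    · exact hd t (hv.trans h.le)

/-- For a radial function `u = γ(ω_n |x|^n)`, differences of means of `γ` against probability
densities supported in `(a, b)` are controlled by the weak gradient on the shell. -/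
theorem enorm_integral_sub_integral_le {n : ℕ} (hn : 2 ≤ n)
    {u : EuclideanSpace ℝ (Fin n) → ℝ} {G : EuclideanSpace ℝ (Fin n) → EuclideanSpace ℝ (Fin n)}
    (h : HasWeakGradient u G) {γ : ℝ → ℝ} (hγ : Measurable γ)
    (hu : ∀ᵐ x, u x = γ (radialVolume n x)) {a b : ℝ} (ha : 0 ≤ a)
    (hγi : Integrable ((Ioo a b).indicator γ)) {c d : ℝ} (hac : a < c) (hcd : c ≤ d) (hdb : d < b)
    {α β : ℝ → ℝ} (hα : ContDiff ℝ ∞ α) (hβ : ContDiff ℝ ∞ β) (hα0 : ∀ v, 0 ≤ α v)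
    (hβ0 : ∀ v, 0 ≤ β v) (hαs : ∀ v ∉ Ioo c d, α v = 0) (hβs : ∀ v ∉ Ioo c d, β v = 0)
    (hα1 : ∫ v, α v = 1) (hβ1 : ∫ v, β v = 1) :
    ‖(∫ v, α v * (Ioo a b).indicator γ v) - ∫ v, β v * (Ioo a b).indicator γ v‖ₑ ≤
      shellOsc G a b := by
  have hn0 : (n : ℝ) ≠ 0 := by
    have : n ≠ 0 := by omega
    exact_mod_cast this
  have hint : ∀ {f : ℝ → ℝ}, ∫ v, f v = 1 → Integrable f := fun {f} hf => by
    by_contra hni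
    rw [integral_undef hni] at hf
    exact zero_ne_one hf
  have hαi := hint hα1
  have hβi := hint hβ1
  set ζ : ℝ → ℝ := fun v => α v - β v with hζdef
  have hζ : ContDiff ℝ ∞ ζ := hα.sub hβ
  have hζs : ∀ v ∉ Ioo c d, ζ v = 0 := fun v hv => by
    simp only [hζdef, hαs v hv, hβs v hv, sub_zero]
  obtain ⟨hη, hηd, hηc₀, hηd₀⟩ := integral_zero_primitive hζ hcd
    (fun v hv => hζs v fun h => absurd h.1 (not_lt.2 hv))
    (fun v hv => hζs v fun h => absurd h.2 (not_lt.2 hv))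
    (by rw [integral_sub hαi hβi, hα1, hβ1, sub_self])
  set η : ℝ → ℝ := fun v => ∫ t in c..v, ζ t
  have hηc : ∀ v ≤ c, η v = 0 := hηc₀
  have hηd' : ∀ v, d ≤ v → η v = 0 := hηd₀
  -- η is a difference of two distribution functions with values in [0, 1].
  have hη1 : ∀ v, |η v| ≤ 1 := by
    intro v
    rcases le_total v c with hv | hv
    · rw [hηc v hv]
      simp
    · have e : η v = (∫ t in c..v, α t) - ∫ t in c..v, β t :=
        intervalIntegral.integral_sub hαi.intervalIntegrable hβi.intervalIntegrable
      have hb : ∀ {f : ℝ → ℝ}, (∀ v, 0 ≤ f v) → ∫ v, f v = 1 →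
          0 ≤ (∫ t in c..v, f t) ∧ (∫ t in c..v, f t) ≤ 1 := fun {f} hf hf1 => by
        rw [intervalIntegral.integral_of_le hv]
        refine ⟨integral_nonneg fun t => hf t, ?_⟩
        rw [← hf1]
        exact setIntegral_le_integral (hint hf1) (ae_of_all _ hf)
      obtain ⟨h1, h2⟩ := hb hα0 hα1
      obtain ⟨h3, h4⟩ := hb hβ0 hβ1
      rw [e, abs_le]
      constructor <;> linarith
  -- With this choice vθ = η, so the divergence of θ(V)y is nζ(V), and |θ| ≤ 1/v produces the weight
  -- in `shellOsc`.
  set θ : ℝ → ℝ := fun v => η v / v with hθdef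
  have hc0 : 0 < c := ha.trans_lt hac
  have hθc : ∀ v ≤ c, θ v = 0 := fun v hv => by simp only [hθdef, hηc v hv, zero_div]
  have hθd : ∀ v, d ≤ v → θ v = 0 := fun v hv => by simp only [hθdef, hηd' v hv, zero_div]
  have hθ : ContDiff ℝ ∞ θ := by
    rw [contDiff_iff_contDiffAt]
    intro v
    rcases lt_or_ge v c with hv | hv
    · refine (contDiffAt_const (c := (0 : ℝ))).congr_of_eventuallyEq ?_
      filter_upwards [gt_mem_nhds hv] with w hw
      exact hθc w hw.le
    · exact hη.contDiffAt.div contDiffAt_id (hc0.trans_le hv).ne'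
  have hvθ : (fun v => v * θ v) = η := by
    ext v
    rcases eq_or_ne v 0 with rfl | hv
    · rw [zero_mul, hηc 0 hc0.le]
    · simp only [hθdef]
      field_simp
  have key := h.integral_radial_field hn hθ hc0 hθc hθd
  rw [hvθ, funext fun v => (hηd v).deriv] at key
  have hT := measurePreserving_radialVolume hn
  have hlhs : ∫ y, u y * (n * ζ (radialVolume n y)) =
      n * ∫ v, ζ v * (Ioo a b).indicator γ v := by
    calc ∫ y, u y * (n * ζ (radialVolume n y))
        = ∫ y, n * (ζ (radialVolume n y) * γ (radialVolume n y)) := by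
          refine integral_congr_ae ?_
          filter_upwards [hu] with y hy
          rw [hy]
          ring
      _ = n * ∫ v in Ioi 0, ζ v * γ v := by
          rw [integral_const_mul]
          congr 1
          change _ = ∫ v, ζ v * γ v ∂volPos
          rw [← hT.map_eq]
          exact (integral_map hT.measurable.aemeasurable
            (hζ.continuous.measurable.mul hγ).aestronglyMeasurable).symm
      _ = n * ∫ v, ζ v * γ v := by
          rw [setIntegral_eq_integral_of_forall_compl_eq_zero]
          intro v hv
          rw [hζs v fun hv' => hv (hc0.trans hv'.1), zero_mul]
      _ = _ := by
          congr 1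
          refine integral_congr_ae (ae_of_all _ fun v => ?_)
          by_cases hv : v ∈ Ioo c d
          · simp only
            rw [indicator_of_mem (show v ∈ Ioo a b from ⟨hac.trans hv.1, hv.2.trans hdb⟩)]
          · simp only [hζs v hv, zero_mul]
  have hbd : ∀ {f : ℝ → ℝ}, ContDiff ℝ ∞ f → (∀ v ∉ Ioo c d, f v = 0) →
      Integrable fun v => f v * (Ioo a b).indicator γ v := fun {f} hf hfs => by
    have hcs : HasCompactSupport f := HasCompactSupport.intro isCompact_Icc fun v hv =>
      hfs v fun h => hv ⟨h.1.le, h.2.le⟩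
    obtain ⟨C, hC⟩ := hf.continuous.bounded_above_of_compact_support hcs
    exact hγi.bdd_mul hf.continuous.aestronglyMeasurable (ae_of_all _ hC)
  have hdiff : (∫ v, α v * (Ioo a b).indicator γ v) - ∫ v, β v * (Ioo a b).indicator γ v =
      ∫ v, ζ v * (Ioo a b).indicator γ v := by
    rw [← integral_sub (hbd hα hαs) (hbd hβ hβs)]
    simp only [hζdef, sub_mul]
  have hsolve : ∫ v, ζ v * (Ioo a b).indicator γ v =
      -((n : ℝ)⁻¹ * ∫ y, inner ℝ (G y) y * θ (radialVolume n y)) := by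
    rw [← mul_neg, ← key, hlhs, ← mul_assoc, inv_mul_cancel₀ hn0, one_mul]
  rw [hdiff, hsolve, enorm_neg, enorm_mul, shellOsc, enorm_inv hn0]
  gcongr
  · rw [Real.enorm_of_nonneg (Nat.cast_nonneg n), ENNReal.ofReal_natCast]
  · refine (enorm_integral_le_lintegral_enorm _).trans ?_
    rw [← lintegral_indicator (measurableSet_volShell n a b)]
    refine lintegral_mono fun y => ?_
    by_cases hy : y ∈ volShell n a b
    · rw [indicator_of_mem hy, enorm_mul]
      have hV := radialVolume_nonneg n y
      calc ‖(inner ℝ (G y) y : ℝ)‖ₑ * ‖θ (radialVolume n y)‖ₑ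
          ≤ ENNReal.ofReal (‖G y‖ * ‖y‖) * ENNReal.ofReal (1 / radialVolume n y) := by
            rw [← ofReal_norm, ← ofReal_norm]
            refine mul_le_mul' (ENNReal.ofReal_le_ofReal (norm_inner_le_norm _ _))
              (ENNReal.ofReal_le_ofReal ?_)
            rw [hθdef, Real.norm_eq_abs, abs_div, abs_of_nonneg hV]
            gcongr
            exact hη1 _
        _ = ‖G y‖ₑ * ENNReal.ofReal (‖y‖ / radialVolume n y) := by
            rw [← ofReal_norm, ← ENNReal.ofReal_mul (by positivity),
              ← ENNReal.ofReal_mul (by positivity)]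
            congr 1
            ring
    · have : radialVolume n y ∉ Ioo c d := fun hv => hy ⟨(hac.trans hv.1).le, hv.2.trans hdb⟩
      have : θ (radialVolume n y) = 0 := by
        rw [mem_Ioo, not_and_or, not_lt, not_lt] at this
        exact this.elim (hθc _) (hθd _)
      rw [this]
      simp

/-- Take α and β to be normalised bumps shrinking to x and y. At almost every point the means
converge to the value of γ, and the bound D passes to the limit. -/
theorem ae_enorm_sub_le_of_integral {γ : ℝ → ℝ} {a b : ℝ} {D : ℝ≥0∞}
    (hγi : Integrable ((Ioo a b).indicator γ))
    (h : ∀ c d : ℝ, a < c → c ≤ d → d < b → ∀ α β : ℝ → ℝ, ContDiff ℝ ∞ α → ContDiff ℝ ∞ β →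
      (∀ v, 0 ≤ α v) → (∀ v, 0 ≤ β v) → (∀ v ∉ Ioo c d, α v = 0) → (∀ v ∉ Ioo c d, β v = 0) →
      ∫ v, α v = 1 → ∫ v, β v = 1 →
      ‖(∫ v, α v * (Ioo a b).indicator γ v) - ∫ v, β v * (Ioo a b).indicator γ v‖ₑ ≤ D) :
    ∃ S : Set ℝ, (∀ᵐ v, v ∈ S) ∧ ∀ x ∈ S, ∀ y ∈ S, x ∈ Ioo a b → y ∈ Ioo a b →
      ‖γ x - γ y‖ₑ ≤ D := by
  -- The outer radius is twice the inner one: a.e. convergence of the mollification needs this ratio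
  -- bounded, here by `K = 2`.
  let φ : ℕ → ContDiffBump (0 : ℝ) := fun k =>
    ⟨1 / (k + 1 : ℝ), 2 * (1 / (k + 1 : ℝ)), by positivity, by
      have : 0 < 1 / (k + 1 : ℝ) := by positivity
      linarith⟩
  have hlim : Tendsto (fun k => (φ k).rOut) atTop (𝓝 0) := by
    have := (tendsto_one_div_add_atTop_nhds_zero_nat (𝕜 := ℝ)).const_mul 2
    rwa [mul_zero] at this
  have hae := ContDiffBump.ae_convolution_tendsto_right_of_locallyIntegrable (μ := volume)
    (φ := φ) (K := 2) hlim (Eventually.of_forall fun k => le_rfl) hγi.locallyIntegrable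
  simp only [convolution_eq_swap, ContinuousLinearMap.lsmul_apply, smul_eq_mul] at hae
  refine ⟨{x | Tendsto (fun k => ∫ t, (φ k).normed volume (x - t) * (Ioo a b).indicator γ t) atTop
    (𝓝 ((Ioo a b).indicator γ x))}, hae, fun x hx y hy hxI hyI => ?_⟩
  rw [mem_ofPred_eq, indicator_of_mem hxI] at hx
  rw [mem_ofPred_eq, indicator_of_mem hyI] at hy
  refine le_of_tendsto ((continuous_enorm.tendsto _).comp (hx.sub hy)) ?_
  -- Once the outer radius is below ε, both bumps are supported in a common interval compactly
  -- inside (a, b).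
  set ε := min (min (x - a) (y - a)) (min (b - x) (b - y))
  have hε : 0 < ε := by
    simp only [ε, lt_min_iff, sub_pos]
    exact ⟨⟨hxI.1, hyI.1⟩, hxI.2, hyI.2⟩
  filter_upwards [hlim.eventually_lt_const hε] with k hk
  have h1 : ε ≤ x - a := (min_le_left _ _).trans (min_le_left _ _)
  have h2 : ε ≤ y - a := (min_le_left _ _).trans (min_le_right _ _)
  have h3 : ε ≤ b - x := (min_le_right _ _).trans (min_le_left _ _)
  have h4 : ε ≤ b - y := (min_le_right _ _).trans (min_le_right _ _)
  set r := (φ k).rOut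
  have hr : 0 < r := (φ k).rOut_pos
  have hsm : ∀ z : ℝ, ContDiff ℝ ∞ fun v => (φ k).normed volume (z - v) := fun z =>
    (φ k).contDiff_normed.comp (contDiff_const.sub contDiff_id)
  have hnn : ∀ z v : ℝ, 0 ≤ (φ k).normed volume (z - v) := fun z v => (φ k).nonneg_normed _
  have hone : ∀ z : ℝ, ∫ v, (φ k).normed volume (z - v) = 1 := fun z => by
    rw [integral_sub_left_eq_self (fun v => (φ k).normed volume v)]
    exact (φ k).integral_normed
  have hsupp : ∀ z v : ℝ, r ≤ |z - v| → (φ k).normed volume (z - v) = 0 := fun z v hv => by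
    rw [← Function.notMem_support, (φ k).support_normed_eq, mem_ball_zero_iff, not_lt]
    exact hv
  refine h (min (x - r) (y - r)) (max (x + r) (y + r)) ?_ ?_ ?_ _ _ (hsm x) (hsm y) (hnn x) (hnn y)
    ?_ ?_ (hone x) (hone y)
  · rw [lt_min_iff]
    constructor <;> linarith
  · exact (min_le_left _ _).trans ((by linarith : x - r ≤ x + r).trans (le_max_left _ _))
  · rw [max_lt_iff]
    constructor <;> linarith
  all_goals
    intro v hv
    apply hsupp
    by_contra! hlt
    rw [abs_lt] at hlt
    refine hv ⟨min_lt_iff.2 ?_, lt_max_iff.2 ?_⟩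
  · exact Or.inl (by linarith)
  · exact Or.inl (by linarith)
  · exact Or.inr (by linarith)
  · exact Or.inr (by linarith)

/-- The oscillation of a radial Sobolev function on a shell. -/
theorem IsRadial.ae_enorm_le_add_shellOsc {n : ℕ} (hn : 2 ≤ n)
    {u : EuclideanSpace ℝ (Fin n) → ℝ} (hr : IsRadial u)
    {G : EuclideanSpace ℝ (Fin n) → EuclideanSpace ℝ (Fin n)} (h : HasWeakGradient u G)
    {a b : ℝ} (ha : 0 ≤ a) :
    ∀ᵐ x, ∀ᵐ y, x ∈ volShell n a b → y ∈ volShell n a b → ‖u x‖ₑ ≤ ‖u y‖ₑ + shellOsc G a b := by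
  have hT := measurePreserving_radialVolume hn
  obtain ⟨γ, hγ, hu⟩ := hr.exists_measurable hn h.1.aestronglyMeasurable.aemeasurable
  have hγi : Integrable ((Ioo a b).indicator γ) := by
    rw [integrable_indicator_iff measurableSet_Ioo]
    have hpre := hT.restrict_preimage (measurableSet_Ioo (a := a) (b := b))
    have hK : IsCompact (Metric.closedBall (0 : EuclideanSpace ℝ (Fin n))
      (max 1 (b / ballVolume n))) := isCompact_closedBall _ _
    have hsub : radialVolume n ⁻¹' Ioo a b ⊆ Metric.closedBall (0 : EuclideanSpace ℝ (Fin n))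
        (max 1 (b / ballVolume n)) := by
      intro y hy
      by_contra hy'
      rw [mem_closedBall_zero_iff, not_le, max_lt_iff, div_lt_iff₀ (ballVolume_pos n)] at hy'
      have : ‖y‖ * ballVolume n ≤ ballVolume n * ‖y‖ ^ n := by
        rw [mul_comm]
        gcongr
        · exact (ballVolume_pos n).le
        · exact le_self_pow₀ hy'.1.le (by omega)
      have h2 : ballVolume n * ‖y‖ ^ n < b := hy.2
      linarith
    have hui := (h.1.integrableOn_isCompact hK).mono_set hsub
    have hui' : Integrable (γ ∘ radialVolume n) (volume.restrict (radialVolume n ⁻¹' Ioo a b)) :=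
      hui.congr (ae_restrict_of_ae hu)
    rw [hpre.integrable_comp hγ.aestronglyMeasurable, Measure.restrict_restrict measurableSet_Ioo,
      inter_eq_left.2 fun v (hv : v ∈ Ioo a b) => mem_Ioi.2 (ha.trans_lt hv.1)] at hui'
    exact hui'
  obtain ⟨S, hS, hSD⟩ := ae_enorm_sub_le_of_integral hγi
    fun c d hac hcd hdb α β hα hβ hα0 hβ0 hαs hβs hα1 hβ1 =>
      enorm_integral_sub_integral_le hn h hγ hu ha hγi hac hcd hdb hα hβ hα0 hβ0 hαs hβs hα1 hβ1
  -- The sphere V = a is discarded because shells are half-open, whereas the estimate for γ lives on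
  -- the open interval.
  have hgood : ∀ᵐ x, u x = γ (radialVolume n x) ∧ radialVolume n x ∈ S ∧ radialVolume n x ≠ a := by
    filter_upwards [hu, hT.quasiMeasurePreserving.ae (ae_restrict_of_ae hS),
      hT.quasiMeasurePreserving.ae (ae_restrict_of_ae (Measure.ae_ne volume a))] with x h1 h2 h3
    exact ⟨h1, h2, h3⟩
  filter_upwards [hgood] with x hx
  filter_upwards [hgood] with y hy hxm hym
  have hI : ∀ z, radialVolume n z ≠ a → z ∈ volShell n a b → radialVolume n z ∈ Ioo a b :=
    fun z hz hzm => ⟨lt_of_le_of_ne hzm.1 (Ne.symm hz), hzm.2⟩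
  have := hSD _ hx.2.1 _ hy.2.1 (hI x hx.2.2 hxm) (hI y hy.2.2 hym)
  rw [← hx.1, ← hy.1] at this
  calc ‖u x‖ₑ = ‖u y + (u x - u y)‖ₑ := by rw [add_sub_cancel]
    _ ≤ ‖u y‖ₑ + ‖u x - u y‖ₑ := enorm_add_le _ _
    _ ≤ _ := by gcongr

/-- A radial Sobolev function is bounded on a shell by its average and its oscillation. -/
theorem IsRadial.ae_enorm_le_lavg_add_shellOsc {n : ℕ} (hn : 2 ≤ n)
    {u : EuclideanSpace ℝ (Fin n) → ℝ} (hr : IsRadial u)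
    {G : EuclideanSpace ℝ (Fin n) → EuclideanSpace ℝ (Fin n)} (h : HasWeakGradient u G)
    {a b c : ℝ} (ha : 0 ≤ a) (hac : a ≤ c) (hcb : c < b) :
    ∀ᵐ x, x ∈ volShell n a b →
      ‖u x‖ₑ ≤ lavg (fun y => ‖u y‖ₑ) (volShell n c b) + shellOsc G a b := by
  have hv : volume (volShell n c b) = ENNReal.ofReal (b - c) := volume_volShell hn (ha.trans hac)
  have hv0 : volume (volShell n c b) ≠ 0 := by
    rw [hv]
    exact (ENNReal.ofReal_pos.2 (sub_pos.2 hcb)).ne'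
  have hv1 : volume (volShell n c b) ≠ ⊤ := by
    rw [hv]
    exact ENNReal.ofReal_ne_top
  filter_upwards [hr.ae_enorm_le_add_shellOsc hn h (b := b) ha] with x hx hxm
  have hsub : volShell n c b ⊆ volShell n a b := fun y hy => ⟨hac.trans hy.1, hy.2⟩
  -- The pointwise comparison of u(x) with u(y) is averaged over y in the outer part of the shell.
  have h1 : ∫⁻ _ in volShell n c b, ‖u x‖ₑ ≤
      ∫⁻ y in volShell n c b, (‖u y‖ₑ + shellOsc G a b) := by
    refine setLIntegral_mono_ae' (measurableSet_volShell n c b) ?_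
    filter_upwards [hx] with y hy hym
    exact hy hxm (hsub hym)
  rw [lintegral_const, Measure.restrict_apply_univ, lintegral_add_right _ measurable_const,
    lintegral_const, Measure.restrict_apply_univ] at h1
  calc ‖u x‖ₑ = (volume (volShell n c b))⁻¹ * (‖u x‖ₑ * volume (volShell n c b)) := by
        rw [mul_comm, mul_assoc, ENNReal.mul_inv_cancel hv0 hv1, mul_one]
    _ ≤ (volume (volShell n c b))⁻¹ * ((∫⁻ y in volShell n c b, ‖u y‖ₑ) +
          shellOsc G a b * volume (volShell n c b)) := by gcongr
    _ = _ := by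
        rw [mul_add, lavg]
        congr 1
        rw [mul_comm, mul_assoc, ENNReal.mul_inv_cancel hv0 hv1, mul_one]

/-! ### Shell volumes and the estimate for radii at least one -/

theorem pow_add_sub_pow_le (n : ℕ) {r s : ℝ} (hr : 0 ≤ r) (hs : 0 ≤ s) :
    (r + s) ^ n - r ^ n ≤ n * s * (r + s) ^ (n - 1) := by
  have := abs_pow_sub_pow_le (r + s) r n
  rw [add_sub_cancel_left, abs_of_nonneg hs, abs_of_nonneg (add_nonneg hr hs), abs_of_nonneg hr,
    max_eq_left (by linarith)] at this
  have h2 := le_abs_self ((r + s) ^ n - r ^ n)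
  linarith

theorem mul_pow_le_pow_add_sub_pow {n : ℕ} (hn : n ≠ 0) {r s : ℝ} (hr : 0 ≤ r) (hs : 0 ≤ s) :
    s * r ^ (n - 1) ≤ (r + s) ^ n - r ^ n := by
  obtain ⟨m, rfl⟩ := Nat.exists_eq_succ_of_ne_zero hn
  have : r ^ m ≤ (r + s) ^ m := by
    gcongr
    linarith
  have h2 : (r + s) * r ^ m ≤ (r + s) * (r + s) ^ m := by gcongr
  simp only [Nat.succ_eq_add_one, Nat.add_sub_cancel, pow_succ]
  linarith

section

variable {n : ℕ}

theorem radialVolume_lt_iff (hn : 2 ≤ n) {r : ℝ} (hr : 0 ≤ r) (x : EuclideanSpace ℝ (Fin n)) :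
    radialVolume n x < ballVolume n * r ^ n ↔ ‖x‖ < r := by
  rw [radialVolume_eq, mul_lt_mul_iff_right₀ (ballVolume_pos n),
    pow_lt_pow_iff_left₀ (norm_nonneg x) hr (by omega)]

theorem le_radialVolume_iff (hn : 2 ≤ n) {r : ℝ} (hr : 0 ≤ r) (x : EuclideanSpace ℝ (Fin n)) :
    ballVolume n * r ^ n ≤ radialVolume n x ↔ r ≤ ‖x‖ := by
  rw [← not_lt, radialVolume_lt_iff hn hr, not_lt]

theorem volume_mul_lavg (hn : 2 ≤ n) (f : EuclideanSpace ℝ (Fin n) → ℝ≥0∞) {a b : ℝ}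
    (ha : 0 ≤ a) (hab : a < b) :
    ENNReal.ofReal (b - a) * lavg f (volShell n a b) = ∫⁻ y in volShell n a b, f y := by
  rw [lavg, volume_volShell hn ha, ← mul_assoc, ENNReal.mul_inv_cancel
    (ENNReal.ofReal_pos.2 (sub_pos.2 hab)).ne' ENNReal.ofReal_ne_top, one_mul]

theorem lavg_mono {f g : EuclideanSpace ℝ (Fin n) → ℝ≥0∞} (h : ∀ᵐ x, f x ≤ g x)
    (s : Set (EuclideanSpace ℝ (Fin n))) : lavg f s ≤ lavg g s := by
  unfold lavg
  gcongr 1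
  exact lintegral_mono_ae (ae_restrict_of_ae h)

/-- The weight |y|/V equals 1/(ω_n|y|^{n-1}), which is largest at the inner radius; the factor n⁻¹ ≤
1 is dropped. -/
theorem shellOsc_le_lintegral (hn : 2 ≤ n)
    {G : EuclideanSpace ℝ (Fin n) → EuclideanSpace ℝ (Fin n)}
    {h : EuclideanSpace ℝ (Fin n) → ℝ≥0∞} (hG : ∀ᵐ x, ‖G x‖ₑ ≤ h x) {r : ℝ} (hr : 0 < r)
    (b : ℝ) :
    shellOsc G (ballVolume n * r ^ n) b ≤ ENNReal.ofReal (1 / (ballVolume n * r ^ (n - 1))) *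
      ∫⁻ y in volShell n (ballVolume n * r ^ n) b, h y := by
  have hw := ballVolume_pos n
  have h1 : (n : ℝ≥0∞)⁻¹ ≤ 1 := ENNReal.inv_le_one.2 (by exact_mod_cast (by omega : 1 ≤ n))
  refine (mul_le_of_le_one_left zero_le h1).trans ?_
  rw [← lintegral_const_mul' _ _ ENNReal.ofReal_ne_top]
  refine setLIntegral_mono_ae' (measurableSet_volShell n _ _) ?_
  filter_upwards [hG] with y hy hym
  rw [mul_comm]
  refine mul_le_mul' (ENNReal.ofReal_le_ofReal ?_) hy
  have hry : r ≤ ‖y‖ := (le_radialVolume_iff hn hr.le y).1 hym.1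
  have hy0 : 0 < ‖y‖ := hr.trans_le hry
  have e : ‖y‖ ^ n = ‖y‖ ^ (n - 1) * ‖y‖ := by
    rw [← pow_succ, Nat.sub_add_cancel (by omega)]
  rw [radialVolume_eq, e, ← mul_assoc, div_mul_cancel_right₀ hy0.ne', ← one_div]
  gcongr

theorem shellOsc_le_sum (G : EuclideanSpace ℝ (Fin n) → EuclideanSpace ℝ (Fin n)) (v : ℕ → ℝ)
    {i J : ℕ} (hiJ : i ≤ J) :
    shellOsc G (v i) (v J) ≤ ∑ j ∈ Finset.Ico i J, shellOsc G (v j) (v (j + 1)) := by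
  induction J, hiJ using Nat.le_induction with
  | base => simp [shellOsc, volShell]
  | succ J hiJ ih =>
    rw [Finset.sum_Ico_succ_top hiJ]
    refine le_trans ?_ (add_le_add ih le_rfl)
    simp only [shellOsc]
    rw [← mul_add]
    gcongr
    refine (lintegral_mono_set ?_).trans (lintegral_union_le _ _ _)
    intro y hy
    rcases lt_or_ge (radialVolume n y) (v J) with h | h
    · exact Or.inl ⟨hy.1, h⟩
    · exact Or.inr ⟨h, hy.2⟩

/-- A Borel representative of |u| + |∇u| majorises both terms, and its norm is at most the Sobolev
norm. -/
theorem exists_measurable_majorant {X : RINorm (volume : Measure (EuclideanSpace ℝ (Fin n)))}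
    {u : EuclideanSpace ℝ (Fin n) → ℝ} (hu : MemW1 X u) :
    ∃ h : EuclideanSpace ℝ (Fin n) → ℝ≥0∞, Measurable h ∧ (∀ᵐ x, ‖u x‖ₑ ≤ h x) ∧
      (∀ᵐ x, ‖weakGradient u x‖ₑ ≤ h x) ∧ X.norm h ≤ normW1 X u ∧ X.norm h < ⊤ := by
  obtain ⟨⟨hum, hu1⟩, -, hGm, hG1⟩ := hu
  simp only [enorm_norm] at hG1
  have hm1 : AEMeasurable fun x => ‖u x‖ₑ := hum.enorm
  have hm2 : AEMeasurable fun x => ‖weakGradient u x‖ₑ := by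
    have := hGm.enorm
    simpa only [enorm_norm] using this
  have hm := hm1.add hm2
  have hle : X.norm (hm.mk _) ≤ normW1 X u :=
    (X.mono _ _ hm.measurable_mk.aemeasurable hm (hm.ae_eq_mk.mono fun x hx => hx.ge)).trans
      (X.add_le _ _ hm1 hm2)
  refine ⟨hm.mk _, hm.measurable_mk, ?_, ?_, hle, hle.trans_lt (ENNReal.add_lt_top.2 ⟨hu1, hG1⟩)⟩
  · filter_upwards [hm.ae_eq_mk] with x hx
    rw [← hx]
    change _ ≤ ‖u x‖ₑ + ‖weakGradient u x‖ₑ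
    exact le_self_add
  · filter_upwards [hm.ae_eq_mk] with x hx
    rw [← hx]
    change _ ≤ ‖u x‖ₑ + ‖weakGradient u x‖ₑ
    exact le_add_self

theorem MemW1.hasWeakGradient {X : RINorm (volume : Measure (EuclideanSpace ℝ (Fin n)))}
    {u : EuclideanSpace ℝ (Fin n) → ℝ} (hu : MemW1 X u) : HasWeakGradient u (weakGradient u) := by
  rw [weakGradient, dif_pos hu.2.1]
  exact hu.2.1.choose_spec

/-- The constant in the estimate outside a ball of radius at least one. -/
def outerConst (n : ℕ) : ℝ :=
  1 + n * (2 / ballVolume n) * (1 + 2 / ballVolume n) ^ (n - 1)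

/-- Shells of fixed thickness have volume comparable to r^{n-1} when r ≥ 1. This makes them large
enough for the tail constant at R^{n-1}, and thin enough for the oscillation to be bounded by a mean
of the gradient. -/
theorem tailNorm_le_of_one_le (hn : 2 ≤ n)
    (X Y : RINorm (volume : Measure (EuclideanSpace ℝ (Fin n)))) {R : ℝ} (hR : 1 ≤ R)
    {u : EuclideanSpace ℝ (Fin n) → ℝ} (hu : u ∈ radialW1 X) :
    tailNorm Y R u ≤ ENNReal.ofReal (outerConst n) *
      (2 * tailConstant (X.rep hn) (Y.rep hn) (R ^ (n - 1)) * normW1 X u) := by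
  obtain ⟨hW, hrad⟩ := hu
  obtain ⟨h, hh, huh, hGh, hXh, hfin⟩ := exists_measurable_majorant hW
  have hw := ballVolume_pos n
  -- The volume of a shell of thickness L is at least ω_n L R^{n-1}, which is 2R^{n-1} for this L.
  set L := 2 / ballVolume n with hL
  have hL0 : 0 < L := by positivity
  let r : ℕ → ℝ := fun k => R + k * L
  have hr1 : ∀ k, 1 ≤ r k := fun k => hR.trans (le_add_of_nonneg_right (by positivity))
  have hrR : ∀ k, R ≤ r k := fun k => le_add_of_nonneg_right (by positivity)
  have hr0 : ∀ k, 0 ≤ r k := fun k => zero_le_one.trans (hr1 k)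
  have hrs : ∀ k, r (k + 1) = r k + L := fun k => by
    simp only [r]
    push_cast
    ring
  let v : ℕ → ℝ := fun k => ballVolume n * r k ^ n
  have hvs : ∀ k, v (k + 1) - v k = ballVolume n * ((r k + L) ^ n - r k ^ n) := fun k => by
    simp only [v, hrs]
    ring
  have hlow : ∀ k, 2 * R ^ (n - 1) ≤ v (k + 1) - v k := fun k => by
    have h1 := mul_pow_le_pow_add_sub_pow (n := n) (by omega) (hr0 k) hL0.le
    calc 2 * R ^ (n - 1) = ballVolume n * (L * R ^ (n - 1)) := by
          rw [hL]
          field_simp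
      _ ≤ ballVolume n * (L * r k ^ (n - 1)) := by
          gcongr
          exact hrR k
      _ ≤ _ := by
          rw [hvs]
          gcongr
  have hv : StrictMono v := strictMono_nat_of_lt_succ fun k => by
    have := hlow k
    have : 0 < 2 * R ^ (n - 1) := by positivity
    linarith
  have hv0 : ∀ k, 0 ≤ v k := fun k => mul_nonneg hw.le (pow_nonneg (hr0 k) n)
  set A : ℕ → Set (EuclideanSpace ℝ (Fin n)) := fun k => volShell n (v k) (v (k + 1))
  have hbound : ∀ᵐ x, ∀ k, x ∈ A k → ‖u x‖ₑ ≤ ENNReal.ofReal (outerConst n) * lavg h (A k) := by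
    rw [ae_all_iff]
    intro k
    filter_upwards [hrad.ae_enorm_le_lavg_add_shellOsc hn hW.hasWeakGradient (hv0 k) le_rfl
      (hv (Nat.lt_succ_self k))] with x hx hxk
    refine (hx hxk).trans ?_
    have hrpos : 0 < r k := zero_lt_one.trans_le (hr1 k)
    -- Here r ≥ 1 enters: r + L ≤ (1 + L)r bounds the shell volume by a constant times ω_n r^{n-1}.
    have h1 : shellOsc (weakGradient u) (v k) (v (k + 1)) ≤
        ENNReal.ofReal (n * L * (1 + L) ^ (n - 1)) * lavg h (A k) := by
      refine (shellOsc_le_lintegral hn hGh hrpos _).trans ?_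
      rw [← volume_mul_lavg hn h (hv0 k) (hv (Nat.lt_succ_self k)), ← mul_assoc,
        ← ENNReal.ofReal_mul (by positivity)]
      refine mul_le_mul' (ENNReal.ofReal_le_ofReal ?_) le_rfl
      rw [hvs, one_div_mul_eq_div, mul_div_mul_left _ _ hw.ne', div_le_iff₀ (by positivity)]
      refine (pow_add_sub_pow_le n (hr0 k) hL0.le).trans ?_
      rw [mul_assoc (n * L), ← mul_pow]
      gcongr
      have := mul_le_mul_of_nonneg_left (hr1 k) hL0.le
      linarith
    calc _ ≤ lavg h (A k) + ENNReal.ofReal (n * L * (1 + L) ^ (n - 1)) * lavg h (A k) :=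
          add_le_add (lavg_mono huh _) h1
      _ = _ := by
          rw [outerConst, ENNReal.ofReal_add zero_le_one (by positivity), ENNReal.ofReal_one,
            add_mul, one_mul]
  set F : EuclideanSpace ℝ (Fin n) → ℝ≥0∞ := fun x =>
    ⨆ k, (A k).indicator (fun _ => lavg h (A k)) x
  have hF : AEMeasurable F :=
    AEMeasurable.iSup fun k => aemeasurable_const.indicator (measurableSet_volShell n _ _)
  have hXF : X.norm F ≤ X.norm h := X.norm_iSup_lavg_le hn hv (hv0 0) hh
  have hcov : ∀ x, x ∉ Metric.ball (0 : EuclideanSpace ℝ (Fin n)) R → ∃ k, x ∈ A k := by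
    intro x hx
    rw [mem_ball_zero_iff, not_lt] at hx
    set t := (‖x‖ - R) / L
    have ht : 0 ≤ t := div_nonneg (by linarith) hL0.le
    refine ⟨⌊t⌋₊, (le_radialVolume_iff hn (hr0 _) x).2 ?_, (radialVolume_lt_iff hn (hr0 _) x).2 ?_⟩
    · have := (le_div_iff₀ hL0).1 (Nat.floor_le ht)
      simp only [r]
      linarith
    · have := (div_lt_iff₀ hL0).1 (Nat.lt_floor_add_one t)
      simp only [r]
      push_cast
      linarith
  have hmeas : AEMeasurable fun x =>
      ‖(Metric.ball (0 : EuclideanSpace ℝ (Fin n)) R)ᶜ.indicator u x‖ₑ :=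
    (hW.1.1.indicator Metric.isOpen_ball.measurableSet.compl).enorm
  calc tailNorm Y R u ≤ Y.norm fun x => ENNReal.ofReal (outerConst n) * F x := by
        refine Y.mono _ _ hmeas (hF.const_mul _) ?_
        filter_upwards [hbound] with x hx
        by_cases hxR : x ∈ Metric.ball (0 : EuclideanSpace ℝ (Fin n)) R
        · rw [indicator_of_notMem (notMem_compl_iff.2 hxR), enorm_zero]
          exact zero_le
        · obtain ⟨k, hk⟩ := hcov x hxR
          rw [indicator_of_mem (show x ∈ (Metric.ball (0 : EuclideanSpace ℝ (Fin n)) R)ᶜ from hxR)]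
          refine (hx k hk).trans ?_
          gcongr
          exact le_iSup_of_le k (by rw [indicator_of_mem hk])
    _ ≤ ENNReal.ofReal (outerConst n) * Y.norm F := Y.norm_const_mul_le _ hF
    _ ≤ ENNReal.ofReal (outerConst n) *
        (2 * tailConstant (X.rep hn) (Y.rep hn) (R ^ (n - 1)) * X.norm F) := by
        gcongr
        refine X.norm_le_tailConstant_mul hn Y (by positivity) hF (hXF.trans_lt hfin)
          fun l _ _ => ?_
        -- A superlevel set of `F` is a union of whole shells, hence empty or of volume at least
        -- 2R^{n-1}.
        by_cases hl : ∃ k, l < lavg h (A k)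
        · obtain ⟨k, hk⟩ := hl
          right
          calc ENNReal.ofReal (2 * R ^ (n - 1)) ≤ volume (A k) := by
                rw [volume_volShell hn (hv0 k)]
                exact ENNReal.ofReal_le_ofReal (hlow k)
            _ ≤ distribution volume F l := by
                refine measure_mono fun x hx => hk.trans_le (le_iSup_of_le k ?_)
                rw [indicator_of_mem hx]
        · left
          simp only [not_exists, not_lt] at hl
          have : {x | l < F x} = ∅ := by
            ext x
            simp only [mem_ofPred_eq, mem_empty_iff_false, iff_false, not_lt]
            refine iSup_le fun k => ?_
            by_cases hx : x ∈ A k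
            · rw [indicator_of_mem hx]
              exact hl k
            · rw [indicator_of_notMem hx]
              exact zero_le
          rw [distribution, this, measure_empty]
    _ ≤ _ := by
        gcongr
        exact hXF.trans hXh

end

/-! ### Radii below one: dyadic balls -/

section

variable {n : ℕ}

/-- The constant in the estimate between a small ball and the unit ball. -/
def innerConst (n : ℕ) : ℝ := 2 * (2 * 2 ^ n * (8 + 2 / ballVolume n))

theorem ballVolume_mul_two_mul_pow (n : ℕ) (r : ℝ) :
    ballVolume n * (2 * r) ^ n = 2 ^ n * (ballVolume n * r ^ n) := by
  rw [mul_pow]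
  ring

/-- A dyadic pointwise bound for radial Sobolev functions near the origin. -/
theorem ae_enorm_le_sum_dyadic (hn : 2 ≤ n)
    {X : RINorm (volume : Measure (EuclideanSpace ℝ (Fin n)))}
    {u : EuclideanSpace ℝ (Fin n) → ℝ} (hu : u ∈ radialW1 X)
    {h : EuclideanSpace ℝ (Fin n) → ℝ≥0∞} (huh : ∀ᵐ x, ‖u x‖ₑ ≤ h x)
    (hGh : ∀ᵐ x, ‖weakGradient u x‖ₑ ≤ h x) {R : ℝ} (hR : 0 < R) {m : ℕ}
    (hm : 1 ≤ 2 ^ m * R) :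
    ∀ᵐ x, R ≤ ‖x‖ → ‖x‖ < 2 ^ (m + 1) * R →
      ‖u x‖ₑ ≤ ∑ j ∈ Finset.range (m + 1),
        (volShell n 0 (ballVolume n * (2 ^ (j + 1) * R) ^ n)).indicator
          (fun _ => ENNReal.ofReal (2 * 2 ^ n * (2 ^ j * R)) *
            lavg h (volShell n 0 (ballVolume n * (2 ^ (j + 1) * R) ^ n))) x := by
  obtain ⟨hW, hrad⟩ := hu
  have hw := ballVolume_pos n
  let r : ℕ → ℝ := fun j => 2 ^ j * R
  have hr : ∀ j, 0 < r j := fun j => by positivity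
  have hrs : ∀ j, r (j + 1) = 2 * r j := fun j => by
    simp only [r, pow_succ]
    ring
  let v : ℕ → ℝ := fun j => ballVolume n * r j ^ n
  have hv0 : ∀ j, 0 < v j := fun j => mul_pos hw (pow_pos (hr j) n)
  have hvs : ∀ j, v (j + 1) = 2 ^ n * v j := fun j => by
    simp only [v, hrs]
    exact ballVolume_mul_two_mul_pow n _
  have h2n : (2 : ℝ) ≤ 2 ^ n := by
    calc (2 : ℝ) = 2 ^ 1 := (pow_one 2).symm
      _ ≤ 2 ^ n := pow_le_pow_right₀ one_le_two (by omega)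
  have hv : StrictMono v := strictMono_nat_of_lt_succ fun j => by
    have := hv0 j
    rw [hvs]
    nlinarith
  have hrmono : StrictMono r := strictMono_nat_of_lt_succ fun j => by
    have := hr j
    rw [hrs]
    linarith
  -- The means are taken over full balls rather than annuli, so that `lavg_mul_norm_indicator_le`
  -- applies to each term.
  let a : ℕ → ℝ≥0∞ := fun j => lavg h (volShell n 0 (v (j + 1)))
  have hosc : ∀ j, shellOsc (weakGradient u) (v j) (v (j + 1)) ≤
      ENNReal.ofReal (2 ^ n * r j) * a j := by
    intro j
    refine (shellOsc_le_lintegral hn hGh (hr j) _).trans ?_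
    calc _ ≤ ENNReal.ofReal (1 / (ballVolume n * r j ^ (n - 1))) *
          ∫⁻ y in volShell n 0 (v (j + 1)), h y := by
          have hsub : volShell n (ballVolume n * r j ^ n) (v (j + 1)) ⊆ volShell n 0 (v (j + 1)) :=
            fun y hy => ⟨radialVolume_nonneg n y, hy.2⟩
          gcongr
      _ = _ := by
          rw [← volume_mul_lavg hn h le_rfl (hv0 _), ← mul_assoc,
            ← ENNReal.ofReal_mul (by have := hr j; positivity), sub_zero]
          change _ * a j = _
          congr 2
          rw [hvs]
          have e : r j ^ n = r j ^ (n - 1) * r j := by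
            rw [← pow_succ, Nat.sub_add_cancel (by omega)]
          have := hr j
          simp only [v]
          rw [e]
          field_simp
  -- On the outermost annulus r_m ≥ 1, so the mean of |u| fits under the same factor 2^n r_m as the
  -- gradient term: passing from annulus to ball costs at most 2 ≤ 2^n r_m.
  have havg : lavg (fun y => ‖u y‖ₑ) (volShell n (v m) (v (m + 1))) ≤
      ENNReal.ofReal (2 ^ n * r m) * a m := by
    have hpos : 0 < v (m + 1) - v m := sub_pos.2 (hv (Nat.lt_succ_self m))
    refine (lavg_mono huh _).trans ?_
    have h1 : ENNReal.ofReal (v (m + 1) - v m) * lavg h (volShell n (v m) (v (m + 1))) ≤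
        ENNReal.ofReal (v (m + 1)) * a m := by
      have := volume_mul_lavg hn h le_rfl (hv0 (m + 1))
      rw [sub_zero] at this
      rw [volume_mul_lavg hn h (hv0 m).le (hv (Nat.lt_succ_self m)), this]
      exact lintegral_mono_set fun y hy => ⟨radialVolume_nonneg n y, hy.2⟩
    have h2 : ENNReal.ofReal (v (m + 1)) ≤
        ENNReal.ofReal (v (m + 1) - v m) * ENNReal.ofReal (2 ^ n * r m) := by
      rw [← ENNReal.ofReal_mul hpos.le]
      refine ENNReal.ofReal_le_ofReal ?_
      have h3 : v (m + 1) ≤ (v (m + 1) - v m) * 2 := by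
        have := hv0 m
        rw [hvs]
        nlinarith
      have h4 : (2 : ℝ) ≤ 2 ^ n * r m := by
        have : 1 ≤ r m := hm
        nlinarith
      exact h3.trans (by gcongr)
    have hne : ENNReal.ofReal (v (m + 1) - v m) ≠ 0 := (ENNReal.ofReal_pos.2 hpos).ne'
    rw [← ENNReal.mul_le_mul_iff_right hne ENNReal.ofReal_ne_top, ← mul_assoc]
    exact h1.trans (by gcongr)
  have hall : ∀ᵐ x, ∀ i ∈ Finset.range (m + 1), x ∈ volShell n (v i) (v (m + 1)) →
      ‖u x‖ₑ ≤ lavg (fun y => ‖u y‖ₑ) (volShell n (v m) (v (m + 1))) +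
        shellOsc (weakGradient u) (v i) (v (m + 1)) := by
    refine (ae_ball_iff (Finset.countable_toSet (Finset.range (m + 1)))).2 fun i hi => ?_
    exact hrad.ae_enorm_le_lavg_add_shellOsc hn hW.hasWeakGradient (hv0 i).le
      (hv.monotone (Nat.lt_succ_iff.1 (Finset.mem_range.1 hi))) (hv (Nat.lt_succ_self m))
  filter_upwards [hall] with x hx hxR hxm
  obtain ⟨i, hi1, hi2⟩ : ∃ i, r i ≤ ‖x‖ ∧ ‖x‖ < r (i + 1) := by
    obtain ⟨i, h1, h2⟩ := exists_nat_pow_near (x := ‖x‖ / R) (y := 2)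
      ((one_le_div hR).2 hxR) one_lt_two
    exact ⟨i, (le_div_iff₀ hR).1 h1, (div_lt_iff₀ hR).1 h2⟩
  have him : i < m + 1 := hrmono.lt_iff_lt.1 (hi1.trans_lt hxm)
  have hxi : x ∈ volShell n (v i) (v (m + 1)) :=
    ⟨(le_radialVolume_iff hn (hr i).le x).2 hi1, (radialVolume_lt_iff hn (hr _).le x).2 hxm⟩
  have hxj : ∀ j ∈ Finset.Ico i (m + 1), x ∈ volShell n 0 (v (j + 1)) := fun j hj =>
    ⟨radialVolume_nonneg n x, (radialVolume_lt_iff hn (hr _).le x).2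
      (hi2.trans_le (hrmono.monotone (Nat.succ_le_succ (Finset.mem_Ico.1 hj).1)))⟩
  calc ‖u x‖ₑ ≤ ENNReal.ofReal (2 ^ n * r m) * a m +
        ∑ j ∈ Finset.Ico i (m + 1), ENNReal.ofReal (2 ^ n * r j) * a j :=
        (hx i (Finset.mem_range.2 him) hxi).trans (add_le_add havg
          ((shellOsc_le_sum _ v him.le).trans (Finset.sum_le_sum fun j _ => hosc j)))
    -- The mean over the last annulus is absorbed as the j = m term of a second copy of the sum,
    -- whence the constant 2·2^n.
    _ ≤ ∑ j ∈ Finset.Ico i (m + 1), ENNReal.ofReal (2 ^ n * r j) * a j +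
        ∑ j ∈ Finset.Ico i (m + 1), ENNReal.ofReal (2 ^ n * r j) * a j := by
        gcongr
        exact Finset.single_le_sum (f := fun j => ENNReal.ofReal (2 ^ n * r j) * a j)
          (fun _ _ => zero_le) (Finset.mem_Ico.2 ⟨Nat.lt_succ_iff.1 him, Nat.lt_succ_self m⟩)
    _ = ∑ j ∈ Finset.Ico i (m + 1), (volShell n 0 (v (j + 1))).indicator
          (fun _ => ENNReal.ofReal (2 * 2 ^ n * r j) * a j) x := by
        rw [← Finset.sum_add_distrib]
        refine Finset.sum_congr rfl fun j hj => ?_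
        rw [indicator_of_mem (hxj j hj), ← add_mul, ← ENNReal.ofReal_add
          (by have := hr j; positivity) (by have := hr j; positivity)]
        ring_nf
    _ ≤ _ := by
        rw [Finset.range_eq_Ico]
        exact Finset.sum_le_sum_of_subset (Finset.Ico_subset_Ico_left (Nat.zero_le i))

/-- In the quotient part R cancels, leaving a multiple of 2^{-j(n-1)}, at most 2^{-j}/ω_n since n ≥
2. The remaining part is geometric with ratio 2 and is controlled by its last term through 2^m R ≤
2. -/
theorem sum_dyadic_le (hn : 2 ≤ n) {R : ℝ} (hR : 0 < R) {m : ℕ} (hm : 2 ^ m * R ≤ 2) :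
    ∑ j ∈ Finset.range (m + 1), 2 * 2 ^ n * (2 ^ j * R) *
      (2 * R ^ (n - 1) / (ballVolume n * (2 ^ (j + 1) * R) ^ n) + 2) ≤
        2 * 2 ^ n * (8 + 2 / ballVolume n) := by
  have hw := ballVolume_pos n
  obtain ⟨p, rfl⟩ := Nat.exists_eq_add_of_le' hn
  have hterm : ∀ j, 2 * 2 ^ (p + 2) * (2 ^ j * R) *
      (2 * R ^ (p + 2 - 1) / (ballVolume (p + 2) * (2 ^ (j + 1) * R) ^ (p + 2)) + 2) ≤
      2 * 2 ^ (p + 2) * ((1 / ballVolume (p + 2)) * (1 / 2) ^ j + 2 * R * 2 ^ j) := by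
    intro j
    rw [mul_assoc (2 * 2 ^ (p + 2)), mul_add]
    gcongr ?_ * (?_ + ?_)
    · have h1 : (1 : ℝ) ≤ (2 ^ j) ^ p := one_le_pow₀ (one_le_pow₀ one_le_two)
      have h2 : (1 : ℝ) ≤ 2 ^ p := one_le_pow₀ one_le_two
      have e : 2 ^ j * R * (2 * R ^ (p + 2 - 1) /
          (ballVolume (p + 2) * (2 ^ (j + 1) * R) ^ (p + 2))) =
          1 / ballVolume (p + 2) * (1 / 2) ^ j * (1 / (2 * 2 ^ p * (2 ^ j) ^ p)) := by
        rw [show p + 2 - 1 = p + 1 from rfl, div_pow, one_pow]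
        field_simp
        ring
      rw [e]
      refine mul_le_of_le_one_right (by positivity) ?_
      rw [div_le_one (by positivity)]
      nlinarith
    · apply le_of_eq
      ring
  refine (Finset.sum_le_sum fun j _ => hterm j).trans ?_
  rw [← Finset.mul_sum, Finset.sum_add_distrib, ← Finset.mul_sum, ← Finset.mul_sum]
  refine mul_le_mul_of_nonneg_left ?_ (by positivity)
  have h1 : ∑ j ∈ Finset.range (m + 1), (1 / 2 : ℝ) ^ j ≤ 2 := by
    exact sum_geometric_two_le _
  have h2 : ∑ j ∈ Finset.range (m + 1), (2 : ℝ) ^ j = 2 ^ (m + 1) - 1 := by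
    rw [geom_sum_eq (by norm_num)]
    norm_num
  rw [h2]
  have h3 : 1 / ballVolume (p + 2) * ∑ j ∈ Finset.range (m + 1), (1 / 2 : ℝ) ^ j ≤
      2 / ballVolume (p + 2) := by
    rw [one_div_mul_eq_div]
    gcongr
  have h4 : 2 * R * (2 ^ (m + 1) - 1) ≤ 8 := by
    rw [pow_succ]
    nlinarith
  linarith

/-- Each dyadic term is a constant on a ball, so its `Y`-norm is estimated through the indicator of
the ball, and the mean times the `X`-norm of that indicator is at most the norm of `h`. -/
theorem tailNorm_le_of_lt_one (hn : 2 ≤ n)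
    (X Y : RINorm (volume : Measure (EuclideanSpace ℝ (Fin n)))) {R : ℝ} (hR : 0 < R)
    (hR1 : R < 1) {u : EuclideanSpace ℝ (Fin n) → ℝ} (hu : u ∈ radialW1 X) :
    tailNorm Y R u ≤ ENNReal.ofReal (innerConst n) *
      (tailConstant (X.rep hn) (Y.rep hn) (R ^ (n - 1)) * normW1 X u) + tailNorm Y 1 u := by
  obtain ⟨h, hh, huh, hGh, hXh, hfin⟩ := exists_measurable_majorant hu.1
  have hw := ballVolume_pos n
  obtain ⟨m, hm1, hm2⟩ : ∃ m : ℕ, 1 ≤ 2 ^ m * R ∧ 2 ^ m * R ≤ 2 := by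
    obtain ⟨m, h1, h2⟩ := exists_nat_pow_near (x := 1 / R) (y := 2)
      (one_le_one_div hR hR1.le) one_lt_two
    rw [le_div_iff₀ hR] at h1
    rw [div_lt_iff₀ hR] at h2
    refine ⟨m + 1, h2.le, ?_⟩
    rw [pow_succ]
    linarith
  have hb : ∀ j : ℕ, 0 < ballVolume n * (2 ^ (j + 1) * R) ^ n := fun j => by positivity
  set B : ℕ → Set (EuclideanSpace ℝ (Fin n)) := fun j =>
    volShell n 0 (ballVolume n * (2 ^ (j + 1) * R) ^ n) with hB
  have hBm : ∀ j, MeasurableSet (B j) := fun j => measurableSet_volShell n _ _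
  have hBv : ∀ j, volume (B j) = ENNReal.ofReal (ballVolume n * (2 ^ (j + 1) * R) ^ n) :=
    fun j => by rw [hB, volume_volShell hn le_rfl, sub_zero]
  have hBtop : ∀ j, volume (B j) ≠ ⊤ := fun j => by
    rw [hBv]
    exact ENNReal.ofReal_ne_top
  let c : ℕ → ℝ := fun j => 2 * 2 ^ n * (2 ^ j * R)
  have hc : ∀ j, 0 ≤ c j := fun j => by positivity
  -- Finiteness comes from the local integrability axiom; it is needed to pull the constant out of
  -- the indicator norm.
  have hlavg : ∀ j, lavg h (B j) ≠ ⊤ := fun j => by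
    obtain ⟨C, -, hC⟩ := X.lintegral_le (B j) (hBm j) (hBtop j).lt_top
    refine ENNReal.mul_ne_top (ENNReal.inv_ne_top.2 ?_) ?_
    · rw [hBv]
      exact (ENNReal.ofReal_pos.2 (hb j)).ne'
    · exact ((hC h hh.aemeasurable).trans_lt (ENNReal.mul_lt_top ENNReal.coe_lt_top hfin)).ne
  set S := tailConstant (X.rep hn) (Y.rep hn) (R ^ (n - 1))
  -- q_j is the number of copies of B_j needed to reach volume 2R^{n-1}. Below, the integer ⌈q_j⌉ +
  -- 1 is used, which is at least 1 and at most q_j + 2.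
  let q : ℕ → ℝ := fun j => 2 * R ^ (n - 1) / (ballVolume n * (2 ^ (j + 1) * R) ^ n)
  have hq : ∀ j, 0 ≤ q j := fun j => by positivity
  have hterm : ∀ j, Y.norm ((B j).indicator fun _ => ENNReal.ofReal (c j) * lavg h (B j)) ≤
      ENNReal.ofReal (c j * (q j + 2)) * (2 * S * X.norm h) := by
    intro j
    rw [Y.norm_indicator_const (ENNReal.mul_ne_top ENNReal.ofReal_ne_top (hlavg j)) (hBm j)]
    have h1 := X.norm_indicator_le_tailConstant_mul hn Y (a := R ^ (n - 1)) (by positivity)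
      (hBm j) (hBtop j) (⌈q j⌉₊ + 1) (by omega) (by
        rw [hBv, ← ENNReal.ofReal_natCast, ← ENNReal.ofReal_mul (by positivity)]
        refine ENNReal.ofReal_le_ofReal ?_
        have h2 : q j ≤ (⌈q j⌉₊ + 1 : ℕ) := by
          push_cast
          have := Nat.le_ceil (q j)
          linarith
        exact (div_le_iff₀ (hb j)).1 h2)
    have h3 : (((⌈q j⌉₊ + 1 : ℕ)) : ℝ≥0∞) ≤ ENNReal.ofReal (q j + 2) := by
      rw [← ENNReal.ofReal_natCast]
      refine ENNReal.ofReal_le_ofReal ?_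
      push_cast
      have := (Nat.ceil_lt_add_one (hq j)).le
      linarith
    calc ENNReal.ofReal (c j) * lavg h (B j) * Y.norm ((B j).indicator fun _ => 1)
        ≤ ENNReal.ofReal (c j) * lavg h (B j) *
          (2 * S * (ENNReal.ofReal (q j + 2) * X.norm ((B j).indicator fun _ => 1))) := by
          gcongr
          exact h1.trans (by gcongr)
      _ = ENNReal.ofReal (c j) * ENNReal.ofReal (q j + 2) * (2 * S *
          (lavg h (B j) * X.norm ((B j).indicator fun _ => 1))) := by ring
      _ ≤ ENNReal.ofReal (c j) * ENNReal.ofReal (q j + 2) * (2 * S * X.norm h) := by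
          gcongr
          exact X.lavg_mul_norm_indicator_le hn (hb j) hh (hlavg j)
      _ = _ := by rw [← ENNReal.ofReal_mul (hc j)]
  set F : EuclideanSpace ℝ (Fin n) → ℝ≥0∞ := fun x => ∑ j ∈ Finset.range (m + 1),
    (B j).indicator (fun _ => ENNReal.ofReal (c j) * lavg h (B j)) x with hF
  have hFm : AEMeasurable F :=
    Finset.aemeasurable_fun_sum _ fun j _ => aemeasurable_const.indicator (hBm j)
  have hmeas : ∀ r, AEMeasurable fun x =>
      ‖(Metric.ball (0 : EuclideanSpace ℝ (Fin n)) r)ᶜ.indicator u x‖ₑ := fun r =>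
    (hu.1.1.1.indicator Metric.isOpen_ball.measurableSet.compl).enorm
  have hYF : Y.norm F ≤ ENNReal.ofReal (innerConst n) * (S * normW1 X u) := by
    calc Y.norm F ≤ ∑ j ∈ Finset.range (m + 1),
          ENNReal.ofReal (c j * (q j + 2)) * (2 * S * X.norm h) :=
          (Y.norm_sum_le _ (fun j => (B j).indicator fun _ => ENNReal.ofReal (c j) * lavg h (B j))
            fun j _ => aemeasurable_const.indicator (hBm j)).trans
            (Finset.sum_le_sum fun j _ => hterm j)
      _ = ENNReal.ofReal (∑ j ∈ Finset.range (m + 1), c j * (q j + 2)) * (2 * S * X.norm h) := by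
          rw [← Finset.sum_mul, ENNReal.ofReal_sum_of_nonneg fun j _ =>
            mul_nonneg (hc j) (add_nonneg (hq j) zero_le_two)]
      _ ≤ ENNReal.ofReal (2 * 2 ^ n * (8 + 2 / ballVolume n)) * (2 * S * normW1 X u) := by
          gcongr
          exact sum_dyadic_le hn hR hm2
      _ = _ := by
          rw [innerConst, ENNReal.ofReal_mul zero_le_two, ENNReal.ofReal_ofNat]
          ring
  calc tailNorm Y R u ≤ Y.norm (fun x => F x +
        ‖(Metric.ball (0 : EuclideanSpace ℝ (Fin n)) 1)ᶜ.indicator u x‖ₑ) := by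
        refine Y.mono _ _ (hmeas R) (hFm.add (hmeas 1)) ?_
        filter_upwards [ae_enorm_le_sum_dyadic hn hu huh hGh hR hm1] with x hx
        by_cases hxR : ‖x‖ < R
        · rw [indicator_of_notMem (notMem_compl_iff.2 (mem_ball_zero_iff.2 hxR)), enorm_zero]
          exact zero_le
        · rw [indicator_of_mem (by simpa using hxR)]
          by_cases hx1 : ‖x‖ < 1
          · refine (hx (not_lt.1 hxR) ?_).trans le_self_add
            rw [pow_succ]
            linarith
          · rw [indicator_of_mem (by simpa using hx1)]
            exact le_add_self
    _ ≤ Y.norm F + tailNorm Y 1 u := Y.add_le _ _ hFm (hmeas 1)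
    _ ≤ _ := by gcongr

/-! ### Combination of the two ranges and the limit -/

/-- The weighted estimate at infinity for radial Sobolev functions. -/
theorem tailNorm_le (hn : 2 ≤ n)
    (X Y : RINorm (volume : Measure (EuclideanSpace ℝ (Fin n)))) {R : ℝ} (hR : 0 < R)
    {u : EuclideanSpace ℝ (Fin n) → ℝ} (hu : u ∈ radialW1 X) :
    tailNorm Y R u ≤ (innerConst n + 2 * outerConst n).toNNReal *
      tailConstant (X.rep hn) (Y.rep hn) (R ^ (n - 1)) * normW1 X u := by
  have hw := ballVolume_pos n
  have hi : 0 ≤ innerConst n := by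
    unfold innerConst
    positivity
  have ho : 0 ≤ outerConst n := by
    unfold outerConst
    positivity
  set S := tailConstant (X.rep hn) (Y.rep hn) (R ^ (n - 1)) with hS
  have e : ((innerConst n + 2 * outerConst n).toNNReal : ℝ≥0∞) * S * normW1 X u =
      ENNReal.ofReal (innerConst n) * (S * normW1 X u) +
        ENNReal.ofReal (outerConst n) * (2 * S * normW1 X u) := by
    change ENNReal.ofReal (innerConst n + 2 * outerConst n) * S * normW1 X u = _
    rw [ENNReal.ofReal_add hi (by positivity), ENNReal.ofReal_mul zero_le_two,
      ENNReal.ofReal_ofNat]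
    ring
  rw [e]
  rcases le_or_gt 1 R with h1 | h1
  · exact (tailNorm_le_of_one_le hn X Y h1 hu).trans le_add_self
  · refine (tailNorm_le_of_lt_one hn X Y hR h1 hu).trans (add_le_add le_rfl ?_)
    -- The exterior of the unit ball brings the tail constant at 1, which is no larger than the one
    -- at R^{n-1} ≤ 1.
    refine (tailNorm_le_of_one_le hn X Y le_rfl hu).trans ?_
    gcongr
    refine tailConstant_antitone _ _ ?_
    rw [one_pow]
    exact pow_le_one₀ hR.le h1.le

end

end

theorem proposition1p2 (n : ℕ) (hn : 2 ≤ n) :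
    ∃ C : ℝ≥0, 0 < C ∧
      ∀ X Y : RINorm (volume : Measure (EuclideanSpace ℝ (Fin n))),
        (∀ R : ℝ, 0 < R → ∀ u ∈ radialW1 X,
          tailNorm Y R u ≤
            C * tailConstant (X.rep hn) (Y.rep hn) (R ^ (n - 1)) * normW1 X u) ∧
        (Tendsto (fun a : ℝ => tailConstant (X.rep hn) (Y.rep hn) a) atTop (𝓝 0) →
          ∀ M ⊆ radialW1 X, (∃ K : ℝ≥0, ∀ u ∈ M, normW1 X u ≤ K) →
            Tendsto (fun R : ℝ => ⨆ u ∈ M, tailNorm Y R u) atTop (𝓝 0)) := by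
  have hw := ballVolume_pos n
  refine ⟨(innerConst n + 2 * outerConst n).toNNReal, ?_, fun X Y =>
    ⟨fun R hR u hu => tailNorm_le hn X Y hR hu, ?_⟩⟩
  · rw [Real.toNNReal_pos]
    unfold innerConst outerConst
    positivity
  · rintro hlim M hM ⟨K, hK⟩
    set C := (innerConst n + 2 * outerConst n).toNNReal
    have hS : Tendsto (fun R : ℝ => (C : ℝ≥0∞) *
        tailConstant (X.rep hn) (Y.rep hn) (R ^ (n - 1)) * K) atTop (𝓝 0) := by
      -- R^{n-1} tends to infinity because n - 1 ≠ 0.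
      have h1 := hlim.comp (tendsto_pow_atTop (α := ℝ) (by omega : n - 1 ≠ 0))
      have h2 := ENNReal.Tendsto.mul_const (b := (K : ℝ≥0∞)) (ENNReal.Tendsto.const_mul
        (a := (C : ℝ≥0∞)) h1 (Or.inr ENNReal.coe_ne_top)) (Or.inr ENNReal.coe_ne_top)
      simpa using h2
    refine tendsto_of_tendsto_of_tendsto_of_le_of_le' tendsto_const_nhds hS
      (Eventually.of_forall fun _ => zero_le) ?_
    filter_upwards [eventually_gt_atTop 0] with R hR
    refine iSup₂_le fun u hu => (tailNorm_le hn X Y hR (hM hu)).trans ?_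
    gcongr
    exact hK u hu
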